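/- Let $k$ be a $\mathbb Z$-graded commutative ring ($ab=(-1)^{|a||b|}ba$), regarded as having zero differential, let $\mathrm{dg}$ be the category of differential graded $k$-modules and chain maps (differentials of degree $1$), let $S$ be a set, let $\mathcal C$ be a complete and cocomplete category, and let $F:\mathrm{dg}^S\rightleftarrows\mathcal C:U$ be an adjunction ($F$ left adjoint) such that $U$ preserves filtered colimits. For $x\in S$ let $\mathbb K_x\in\mathrm{dg}^S$ be given by $\mathbb K_x(x)=\mathrm{Cone}(1_k)$ and $\mathbb K_x(y)=0$ for $y\neq x$. Assume that $U(\mathrm{in}_2):UA\to U(F(\mathbb K_x[p])\sqcup A)$ is a quasi-isomorphism for all $A\in\mathcal C$, $x\in S$, $p\in\mathbb Z$. For $A\in\mathcal C$ and $\alpha:M\to UA$ in $\mathrm{dg}^S$, let $\bar\jmath:A\to A\langle M,\alpha\rangle$ be the pushout of $F(UA\to\mathrm{Cone}(\alpha)):FUA\to F\,\mathrm{Cone}(\alpha)$ along the counit $FUA\to A$. Say that $N\in\mathrm{dg}^S$ is *free with zero differential* if each $N(x)$ is isomorphic to a direct sum of shifts $k[a]$ with zero differential. The morphism $\bar\jmath$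 is an *elementary standard cofibration* if $M$ is free with zero differential, and a *standard trivial cofibration* if $M=\mathrm{Cone}(1_{N[-1]})$ with $N$ free with zero differential. A *standard cofibration* is the composition $A_0\to\mathrm{colim}_n A_n$ of a sequence $A_0\to A_1\to A_2\to\cdots$ of elementary standard cofibrations. Then $\mathcal C$ is a model category in which $f$ is a weak equivalence (resp. a fibration) iff $Uf$ is a quasi-isomorphism (resp. surjective in every component and degree), the cofibrations being the morphisms with the left lifting property with respect to the trivial fibrations, and: 1. Every trivial cofibration $f:X\to Y$ is a retract, under $X$, of a standard trivial cofibration: there are $M,N\in\mathrm{dg}^S$ with $N$ free with zero differential and $M[1]\cong\mathrm{Cone}(1_{N[-1]})$ such that the canonical morphism $\bar\jmath:X\to X\langle M,0\rangle=F(M[1])\sqcup X$ is a standard trivial cofibration, and there are $w:Y\to X\langle M,0\rangle$ and a trivial fibration $p:X\langle M,0\rangle\to Y$ with $wf=\bar\jmath$, $p\bar\jmath=f$ and $pw=1_Y$. 2. Every cofibration $f:X\to Y$ is a retract, under $X$, of a standard cofibration: there are a standard cofibration $\bar\jmath:X\to Z$, a morphism $w:Y\to Z$ and a trivial fibration $p:Z\to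 Y$ with $wf=\bar\jmath$, $p\bar\jmath=f$ and $pw=1_Y$. 3. The model structure is cofibrantly generated by the class $I$ of elementary standard cofibrations and the class $J$ of standard trivial cofibrations. That is, the trivial fibrations (resp. fibrations) are exactly the morphisms with the right lifting property with respect to $I$ (resp. $J$); the cofibrations (resp. trivial cofibrations) are exactly the morphisms with the left lifting property with respect to those; and $I$ and $J$ contain small sets $I_0\subset I$ and $J_0\subset J$ which permit the small object argument and have the same right lifting properties as $I$ and $J$. -/

import Mathlib

open CategoryTheory Limits HomotopicalAlgebra

universe v u

/-- A differential graded module over a `ℤ`-graded ring `K = ⨁ 𝒜 i` with zero differential: a family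
of abelian groups `X n`, an action `𝒜 i × X m → X (i + m)`, and a `K`-linear differential of
degree `1` and square zero. The differential is regarded as a right operator, so that linearity
reads `(a x) d = a (x d)`, without sign. Equalities of degrees are passed as arguments. -/
structure DGModule {K : Type v} [Ring K] (𝒜 : ℤ → AddSubgroup K) [GradedRing 𝒜] where
  X : ℤ → Type v
  [addCommGroup : ∀ n, AddCommGroup (X n)]
  smul : ∀ {i m n : ℤ}, i + m = n → 𝒜 i → X m → X n
  smul_add : ∀ {i m n : ℤ} (h : i + m = n) (a : 𝒜 i) (x y : X m),
    smul h a (x + y) = smul h a x + smul h a y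
  add_smul : ∀ {i m n : ℤ} (h : i + m = n) (a b : 𝒜 i) (x : X m),
    smul h (a + b) x = smul h a x + smul h b x
  one_smul : ∀ {m : ℤ} (x : X m),
    smul (zero_add m) (⟨1, SetLike.GradedOne.one_mem⟩ : 𝒜 0) x = x
  mul_smul : ∀ {i j m n p : ℤ} (h₁ : j + m = n) (h₂ : i + n = p) (h₃ : (i + j) + m = p)
    (a : 𝒜 i) (b : 𝒜 j) (x : X m),
    smul h₃ (⟨a * b, SetLike.GradedMul.mul_mem a.2 b.2⟩ : 𝒜 (i + j)) x = smul h₂ a (smul h₁ b x)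
  d : ∀ {m n : ℤ}, m + 1 = n → X m →+ X n
  d_d : ∀ {m n p : ℤ} (h₁ : m + 1 = n) (h₂ : n + 1 = p) (x : X m), d h₂ (d h₁ x) = 0
  d_smul : ∀ {i m n m' n' : ℤ} (h : i + m = n) (hm : m + 1 = m') (hn : n + 1 = n')
    (h' : i + m' = n') (a : 𝒜 i) (x : X m), d hn (smul h a x) = smul h' a (d hm x)

namespace DGModule

attribute [instance] DGModule.addCommGroup

variable {K : Type v} [Ring K] {𝒜 : ℤ → AddSubgroup K} [GradedRing 𝒜]

/-- Chain `K`-linear maps of degree `0`. -/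
@[ext]
structure Hom (M N : DGModule 𝒜) where
  f : ∀ n : ℤ, M.X n →+ N.X n
  comm : ∀ {m n : ℤ} (h : m + 1 = n) (x : M.X m), f n (M.d h x) = N.d h (f m x)
  map_smul : ∀ {i m n : ℤ} (h : i + m = n) (a : 𝒜 i) (x : M.X m),
    f n (M.smul h a x) = N.smul h a (f m x)

instance : Category.{v} (DGModule 𝒜) where
  Hom := Hom
  id M := { f := fun n => AddMonoidHom.id _, comm := fun _ _ => rfl, map_smul := fun _ _ _ => rfl }
  comp φ ψ :=
    { f := fun n => (ψ.f n).comp (φ.f n)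
      comm := fun h x => by simp [φ.comm, ψ.comm]
      map_smul := fun h a x => by simp [φ.map_smul, ψ.map_smul] }

lemma smul_zero (M : DGModule 𝒜) {i m n : ℤ} (h : i + m = n) (a : 𝒜 i) :
    M.smul h a (0 : M.X m) = 0 := by
  have := M.smul_add h a 0 0
  simpa using this

lemma smul_neg (M : DGModule 𝒜) {i m n : ℤ} (h : i + m = n) (a : 𝒜 i) (x : M.X m) :
    M.smul h a (-x) = -M.smul h a x := by
  rw [eq_neg_iff_add_eq_zero, ← M.smul_add, neg_add_cancel, smul_zero]

lemma smul_zsmul (M : DGModule 𝒜) {i m n : ℤ} (h : i + m = n) (a : 𝒜 i) (c : ℤ) (x : M.X m) :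
    M.smul h a (c • x) = c • M.smul h a x :=
  map_zsmul (⟨⟨M.smul h a, M.smul_zero h a⟩, M.smul_add h a⟩ : M.X m →+ M.X n) c x

/-- Transport along an equality of degrees. -/
def castHom (M : DGModule 𝒜) {m n : ℤ} (h : m = n) : M.X m →+ M.X n :=
  h ▸ AddMonoidHom.id (M.X m)

@[simp] lemma castHom_rfl (M : DGModule 𝒜) {m : ℤ} (x : M.X m) : M.castHom rfl x = x := rfl

/-- The zero chain map. -/
def zeroHom (M N : DGModule 𝒜) : M ⟶ N where
  f _ := 0
  comm _ _ := by simp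
  map_smul _ _ _ := by simp [smul_zero]

/-- The zero module. -/
def zero : DGModule 𝒜 where
  X _ := PUnit
  smul _ _ _ := 0
  smul_add _ _ _ _ := rfl
  add_smul _ _ _ _ := rfl
  one_smul _ := rfl
  mul_smul _ _ _ _ _ _ := rfl
  d _ := 0
  d_d _ _ _ := rfl
  d_smul _ _ _ _ _ _ := rfl

/-- The cycles of degree `n`. -/
def cycles (M : DGModule 𝒜) (n : ℤ) : AddSubgroup (M.X n) := (M.d (rfl : n + 1 = n + 1)).ker

/-- The boundaries of degree `n`. -/
def boundaries (M : DGModule 𝒜) (n : ℤ) : AddSubgroup (M.X n) :=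
  (M.d (sub_add_cancel n 1)).range

/-- The cohomology of degree `n`: cycles modulo boundaries. -/
abbrev cohomology (M : DGModule 𝒜) (n : ℤ) : Type v :=
  M.cycles n ⧸ (M.boundaries n).addSubgroupOf (M.cycles n)

/-- The map induced on cycles by a chain map. -/
def cyclesMap {M N : DGModule 𝒜} (φ : M ⟶ N) (n : ℤ) : M.cycles n →+ N.cycles n :=
  ((φ.f n).comp (M.cycles n).subtype).codRestrict (N.cycles n) (by
    rintro ⟨x, hx⟩
    change N.d _ (φ.f n x) = 0
    rw [← φ.comm, show M.d _ x = 0 from hx, map_zero])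

/-- The map induced on cohomology by a chain map. -/
def cohomologyMap {M N : DGModule 𝒜} (φ : M ⟶ N) (n : ℤ) : M.cohomology n →+ N.cohomology n :=
  QuotientAddGroup.map _ _ (cyclesMap φ n) (by
    rintro ⟨x, hx⟩ ⟨y, hy⟩
    exact ⟨φ.f _ y, by rw [← φ.comm, hy]; rfl⟩)

/-- Quasi-isomorphisms: chain maps inducing isomorphisms in cohomology. -/
def IsQuasiIso {M N : DGModule 𝒜} (φ : M ⟶ N) : Prop :=
  ∀ n : ℤ, Function.Bijective (cohomologyMap φ n)

/-- The shift `M[a]`, with `M[a]^z = M^{z + a}` and differential multiplied by `(-1)^a`. -/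
def shift (M : DGModule 𝒜) (a : ℤ) : DGModule 𝒜 where
  X z := M.X (z + a)
  smul h b x := M.smul (by omega) b x
  smul_add h b x y := M.smul_add _ b x y
  add_smul h b c x := M.add_smul _ b c x
  one_smul x := M.one_smul x
  mul_smul h₁ h₂ h₃ b c x := M.mul_smul _ _ (by omega) b c x
  d {m n} h := ((a.negOnePow : ℤˣ) : ℤ) • M.d (show m + a + 1 = n + a by omega)
  d_d h₁ h₂ x := by simp [M.d_d]
  d_smul {i m n m' n'} h hm hn h' b x := by
    simp only [AddMonoidHom.smul_apply, smul_zsmul]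
    rw [M.d_smul _ (show m + a + 1 = m' + a by omega) _ (by omega)]

/-- The cone `M[1] ⊕ N` of `α : M ⟶ N`, with differential `(x, y) ↦ (-d x, α x + d y)`. -/
def cone {M N : DGModule 𝒜} (α : M ⟶ N) : DGModule 𝒜 where
  X n := M.X (n + 1) × N.X n
  smul h a x := (M.smul (by omega) a x.1, N.smul h a x.2)
  smul_add h a x y := Prod.ext (M.smul_add _ a _ _) (N.smul_add _ a _ _)
  add_smul h a b x := Prod.ext (M.add_smul _ a b _) (N.add_smul _ a b _)
  one_smul x := Prod.ext (M.one_smul _) (N.one_smul _)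
  mul_smul h₁ h₂ h₃ a b x :=
    Prod.ext (M.mul_smul _ _ (by omega) a b _) (N.mul_smul _ _ _ a b _)
  d {m n} h :=
    { toFun := fun x => (-M.d (show m + 1 + 1 = n + 1 by omega) x.1,
        α.f n (M.castHom h x.1) + N.d h x.2)
      map_zero' := by simp
      map_add' := fun x y => by
        refine Prod.ext ?_ ?_
        · simp only [Prod.fst_add, map_add, neg_add]
        · simp only [Prod.fst_add, Prod.snd_add, map_add]; abel }
  d_d {m n p} h₁ h₂ x := by
    subst h₁ h₂
    refine Prod.ext ?_ ?_
    · simp [M.d_d]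
    · simp [N.d_d, α.comm]
  d_smul {i m n m' n'} h hm hn h' a x := by
    subst hm hn
    refine Prod.ext ?_ ?_
    · simp only [AddMonoidHom.coe_mk, ZeroHom.coe_mk, smul_neg]
      rw [M.d_smul]
    · simp only [AddMonoidHom.coe_mk, ZeroHom.coe_mk, castHom_rfl, N.smul_add]
      rw [α.map_smul, N.d_smul]

/-- The embedding of `N` in the cone of `α : M ⟶ N`. -/
def coneInr {M N : DGModule 𝒜} (α : M ⟶ N) : N ⟶ cone α where
  f n := AddMonoidHom.inr _ _
  comm {m n} h x := by
    subst h
    refine Prod.ext ?_ ?_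
    · change (0 : M.X (m + 1 + 1)) = -M.d _ 0
      simp
    · change N.d _ x = α.f _ (M.castHom rfl 0) + N.d _ x
      simp
  map_smul h a x := Prod.ext (M.smul_zero _ a).symm rfl

variable (𝒜) in
/-- The free module `⨁ P^a K[a]` on a graded set `P`, with zero differential. -/
noncomputable def free (P : ℤ → Type v) : DGModule 𝒜 where
  X n := DirectSum (Σ a, P a) (fun q => 𝒜 (n + q.1))
  smul {i m n} h a x :=
    DFinsupp.mapRange
      (fun q (b : 𝒜 (m + q.1)) => (⟨a * b, by
        have := SetLike.GradedMul.mul_mem a.2 b.2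
        rwa [show i + (m + q.1) = n + q.1 by omega] at this⟩ : 𝒜 (n + q.1)))
      (fun q => Subtype.ext (mul_zero _)) x
  smul_add _ _ _ _ := DFinsupp.ext fun q => Subtype.ext (mul_add _ _ _)
  add_smul _ _ _ _ := DFinsupp.ext fun q => Subtype.ext (add_mul _ _ _)
  one_smul _ := DFinsupp.ext fun q => Subtype.ext (one_mul _)
  mul_smul _ _ _ _ _ _ := DFinsupp.ext fun q => Subtype.ext (mul_assoc _ _ _)
  d _ := 0
  d_d _ _ _ := rfl
  d_smul _ _ _ _ _ _ := DFinsupp.ext fun q => Subtype.ext (mul_zero _).symm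

variable (𝒜) in
/-- The graded ring `K` as a module over itself, with zero differential. -/
def self : DGModule 𝒜 where
  X n := 𝒜 n
  smul h a b := ⟨a * b, h ▸ SetLike.GradedMul.mul_mem a.2 b.2⟩
  smul_add _ _ _ _ := Subtype.ext (mul_add _ _ _)
  add_smul _ _ _ _ := Subtype.ext (add_mul _ _ _)
  one_smul _ := Subtype.ext (one_mul _)
  mul_smul _ _ _ _ _ _ := Subtype.ext (mul_assoc _ _ _)
  d _ := 0
  d_d _ _ _ := rfl
  d_smul _ _ _ _ _ _ := Subtype.ext (mul_zero _).symm

end DGModule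

section Families

variable {K : Type v} [Ring K] {𝒜 : ℤ → AddSubgroup K} [GradedRing 𝒜] {S : Type v}

/-- The object `𝕂_x` of `dg^S`: the cone of the identity of `K` at `x`, and zero elsewhere. -/
noncomputable def dgK (𝒜 : ℤ → AddSubgroup K) [GradedRing 𝒜] (x : S) : S → DGModule 𝒜 :=
  open scoped Classical in
  fun y => if y = x then DGModule.cone (𝟙 (DGModule.self 𝒜)) else DGModule.zero

/-- The componentwise shift in `dg^S`. -/
def dgShift (M : S → DGModule 𝒜) (a : ℤ) : S → DGModule 𝒜 := fun s => (M s).shift a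

/-- The componentwise cone in `dg^S`. -/
def dgCone {M N : S → DGModule 𝒜} (α : M ⟶ N) : S → DGModule 𝒜 :=
  fun s => DGModule.cone (α s)

/-- The embedding `N ⟶ Cone α` in `dg^S`. -/
def dgConeInr {M N : S → DGModule 𝒜} (α : M ⟶ N) : N ⟶ dgCone α :=
  fun s => DGModule.coneInr (α s)

/-- The zero morphism in `dg^S`. -/
def dgZero (M N : S → DGModule 𝒜) : M ⟶ N := fun s => DGModule.zeroHom (M s) (N s)

/-- `N` consists of free `K`-modules and has zero differential. -/
def DGIsFree (N : S → DGModule 𝒜) : Prop :=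
  ∀ s, ∃ P : ℤ → Type v, Nonempty (N s ≅ DGModule.free 𝒜 P)

/-- Quasi-isomorphisms in `dg^S`. -/
def DGIsQuasiIso {M N : S → DGModule 𝒜} (φ : M ⟶ N) : Prop :=
  ∀ s, DGModule.IsQuasiIso (φ s)

/-- Componentwise surjections in `dg^S`. -/
def DGIsEpi {M N : S → DGModule 𝒜} (φ : M ⟶ N) : Prop :=
  ∀ (s : S) (n : ℤ), Function.Surjective ((φ s).f n)

variable {C : Type u} [Category.{v} C]

/-- Morphisms `f` of `C` such that `U f` is a quasi-isomorphism. -/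
def dgWeakEquivalences (U : C ⥤ (S → DGModule 𝒜)) : MorphismProperty C :=
  fun _ _ f => DGIsQuasiIso (U.map f)

/-- Morphisms `f` of `C` such that `U f` is a componentwise surjection. -/
def dgFibrations (U : C ⥤ (S → DGModule 𝒜)) : MorphismProperty C :=
  fun _ _ f => DGIsEpi (U.map f)

/-- Morphisms with the left lifting property with respect to `dgFibrations ⊓ dgWeakEquivalences`. -/
def dgCofibrations (U : C ⥤ (S → DGModule 𝒜)) : MorphismProperty C :=
  (dgFibrations U ⊓ dgWeakEquivalences U).llp

variable {F : (S → DGModule 𝒜) ⥤ C} {U : C ⥤ (S → DGModule 𝒜)}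

/-- `j : A ⟶ D` is (a model of) the canonical morphism `A ⟶ A⟨M, α⟩`: for some `g` the square
with sides `ε : F U A ⟶ A`, `F(U A ⟶ Cone α)`, `j` and `g : F (Cone α) ⟶ D` is a pushout. -/
def IsKilling (adj : F ⊣ U) {A D : C} {M : S → DGModule 𝒜} (α : M ⟶ U.obj A) (j : A ⟶ D) : Prop :=
  ∃ g : F.obj (dgCone α) ⟶ D, IsPushout (adj.counit.app A) (F.map (dgConeInr α)) j g

/-- Elementary standard cofibrations `A ⟶ A⟨M, α⟩`, with `M` free with zero differential. -/
def elementaryStandardCofibrations (adj : F ⊣ U) : MorphismProperty C :=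
  fun A _ j => ∃ (M : S → DGModule 𝒜) (α : M ⟶ U.obj A), DGIsFree M ∧ IsKilling adj α j

/-- Standard cofibrations: compositions `A ⟶ colim A_n` of sequences `A = A_0 ⟶ A_1 ⟶ ⋯` of
elementary standard cofibrations. -/
def standardCofibrations (adj : F ⊣ U) : MorphismProperty C :=
  (elementaryStandardCofibrations adj).transfiniteCompositionsOfShape ℕ

/-- Standard trivial cofibrations `A ⟶ A⟨M, α⟩`, where `M` is the cone of the identity of `N[-1]`
for some `N` free with zero differential. -/
def standardTrivialCofibrations (adj : F ⊣ U) : MorphismProperty C :=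
  fun A _ j => ∃ (N : S → DGModule 𝒜) (α : dgCone (𝟙 (dgShift N (-1))) ⟶ U.obj A),
    DGIsFree N ∧ IsKilling adj α j

end Families

/-- A model category is cofibrantly generated by classes `I` and `J` of morphisms if these classes
determine the four classes of the two weak factorization systems by lifting properties, and if
`I` and `J` contain small sets of morphisms which permit the small object argument and have the
same right lifting property as `I` and `J`. -/
structure IsCofibrantlyGeneratedBy {C : Type u} [Category.{v} C] [ModelCategory C]
    (I J : MorphismProperty C) : Prop where
  trivialFibrations_eq : trivialFibrations C = I.rlp
  fibrations_eq : fibrations C = J.rlp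
  cofibrations_eq : cofibrations C = I.rlp.llp
  trivialCofibrations_eq : trivialCofibrations C = J.rlp.llp
  exists_small_I : ∃ I₀ : MorphismProperty C, I₀ ≤ I ∧ MorphismProperty.IsSmall.{v} I₀ ∧
    MorphismProperty.HasSmallObjectArgument.{v} I₀ ∧ I₀.rlp = I.rlp
  exists_small_J : ∃ J₀ : MorphismProperty C, J₀ ≤ J ∧ MorphismProperty.IsSmall.{v} J₀ ∧
    MorphismProperty.HasSmallObjectArgument.{v} J₀ ∧ J₀.rlp = J.rlp

/-! The extensions `A ⟶ A⟨M, α⟩` become transparent once morphisms out of them are described by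
elements. By adjunction, a morphism `A⟨M, α⟩ ⟶ B` is a morphism `f : A ⟶ B` together with a homotopy
`σ : M ⟶ U B` of degree `-1` satisfying `dσ + σd = U f ∘ α`. If `M` has a basis `g i` and zero
differential, this is a choice of elements `b i` with `d (b i) = f (α (g i))`: the extension adjoins
generators with prescribed differentials (`KillExt`). If `M` is the cone of an identity, it has a
basis of the form `g i`, `d (g i)`. Then `σ (g i)` is arbitrary and `σ (d (g i))` is forced, so the
extension adjoins unconstrained generators, whatever `α` is (`FreeExt`). The differential acts as a
right operator, so graded maps of every degree are linear without signs.

The lifting properties can now be read off. Lifting against free extensions means lifting elements,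
so the right lifting property for `J` is surjectivity. Lifting against the other extensions means
solving `d x = z`, `p x = y` for a cycle `z` with `p z = d y`. This characterizes surjective
quasi-isomorphisms (`liftsBoundaries_iff`), so the right lifting property for `I` singles out the
trivial fibrations.

The hypothesis on `𝕂_x` says that adjoining one free generator is a weak equivalence. Induction
gives finitely many generators. An arbitrary free extension is the filtered colimit of its finite
parts, and both `U` and cohomology commute with filtered colimits (`FreeExt.weakEquivalence`). Hence
standard trivial cofibrations are weak equivalences.

One factorization of `X ⟶ Y` adjoins to `X` a free generator for every homogeneous element of `U Y`.
The other solves all lifting problems `(z, y)` at once and iterates countably often; each problem in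
the colimit already occurs at a finite stage. Retract arguments give the rest, including the
identification of trivial cofibrations with the left lifting class of the fibrations
(`dgFibrations_llp`). The generating sets adjoin one generator at a time, to the initial object or
to an object representing cycles. Both kinds of source are finitely presentable, so the small object
argument applies at `ℵ₀`. -/

namespace DGModule

variable {K : Type v} [Ring K] {𝒜 : ℤ → AddSubgroup K} [GradedRing 𝒜]

lemma hom_ext {M N : DGModule 𝒜} {φ ψ : M ⟶ N} (h : ∀ n x, φ.f n x = ψ.f n x) : φ = ψ :=
  Hom.ext (funext fun n => AddMonoidHom.ext (h n))

@[simp] lemma id_f (M : DGModule 𝒜) (n : ℤ) (x : M.X n) : Hom.f (𝟙 M) n x = x := rfl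

@[simp] lemma comp_f {M N L : DGModule 𝒜} (φ : M ⟶ N) (ψ : N ⟶ L) (n : ℤ) (x : M.X n) :
    Hom.f (φ ≫ ψ) n x = ψ.f n (φ.f n x) := rfl

/-- Multiplication by a homogeneous scalar, as an additive map. -/
def smulHom (M : DGModule 𝒜) {i m n : ℤ} (h : i + m = n) (a : 𝒜 i) : M.X m →+ M.X n :=
  ⟨⟨M.smul h a, M.smul_zero h a⟩, M.smul_add h a⟩

variable (𝒜) in
/-- The functor sending a differential graded module to its component of degree `n`. -/
def ev (n : ℤ) : DGModule 𝒜 ⥤ AddCommGrpCat.{v} where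
  obj M := .of (M.X n)
  map φ := AddCommGrpCat.ofHom (φ.f n)

/-! ### Filtered colimits of differential graded modules -/

section FilteredColimits

variable {J : Type v} [SmallCategory J] (G : J ⥤ DGModule 𝒜)

/-- Multiplication by a scalar on the components of a diagram. -/
def smulNatTrans {i m n : ℤ} (h : i + m = n) (a : 𝒜 i) : G ⋙ ev 𝒜 m ⟶ G ⋙ ev 𝒜 n where
  app j := AddCommGrpCat.ofHom ((G.obj j).smulHom h a)
  naturality j k f := by
    ext x
    exact ((G.map f).map_smul h a x).symm

/-- The differential on the components of a diagram. -/
def dNatTrans {m n : ℤ} (h : m + 1 = n) : G ⋙ ev 𝒜 m ⟶ G ⋙ ev 𝒜 n where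
  app j := AddCommGrpCat.ofHom ((G.obj j).d h)
  naturality j k f := by
    ext x
    exact ((G.map f).comm h x).symm

/-- The structure map to the degreewise colimit. -/
noncomputable def colimIn (n : ℤ) (j : J) :
    (G.obj j).X n →+ (colimit (G ⋙ ev 𝒜 n) : AddCommGrpCat.{v}) :=
  (colimit.ι (G ⋙ ev 𝒜 n) j).hom

/-- Multiplication by a scalar on the degreewise colimit. -/
noncomputable def colimSmul {i m n : ℤ} (h : i + m = n) (a : 𝒜 i) :
    (colimit (G ⋙ ev 𝒜 m) : AddCommGrpCat.{v}) →+ (colimit (G ⋙ ev 𝒜 n) : AddCommGrpCat.{v}) :=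
  (colimMap (smulNatTrans G h a)).hom

lemma colimSmul_in {i m n : ℤ} (h : i + m = n) (a : 𝒜 i) (j : J) (x : (G.obj j).X m) :
    colimSmul G h a (colimIn G m j x) = colimIn G n j ((G.obj j).smul h a x) :=
  ConcreteCategory.congr_hom (ι_colimMap (smulNatTrans G h a) j) x

/-- The differential on the degreewise colimit. -/
noncomputable def colimD {m n : ℤ} (h : m + 1 = n) :
    (colimit (G ⋙ ev 𝒜 m) : AddCommGrpCat.{v}) →+ (colimit (G ⋙ ev 𝒜 n) : AddCommGrpCat.{v}) :=
  (colimMap (dNatTrans G h)).hom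

lemma colimD_in {m n : ℤ} (h : m + 1 = n) (j : J) (x : (G.obj j).X m) :
    colimD G h (colimIn G m j x) = colimIn G n j ((G.obj j).d h x) :=
  ConcreteCategory.congr_hom (ι_colimMap (dNatTrans G h) j) x

/-- The components of the universal map out of the filtered colimit. -/
noncomputable def colimDesc (s : Cocone G) (n : ℤ) :
    (colimit (G ⋙ ev 𝒜 n) : AddCommGrpCat.{v}) →+ s.pt.X n :=
  (colimit.desc (G ⋙ ev 𝒜 n) ((ev 𝒜 n).mapCocone s)).hom

lemma colimDesc_in (s : Cocone G) (n : ℤ) (j : J) (x : (G.obj j).X n) :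
    colimDesc G s n (colimIn G n j x) = (s.ι.app j).f n x :=
  ConcreteCategory.congr_hom (colimit.ι_desc ((ev 𝒜 n).mapCocone s) j) x

variable [IsFiltered J]

/-- Filteredness enters here. Since a single stage represents each element, the module axioms and
the properties of maps out of the colimit can be checked stage by stage. -/
lemma colimIn_surj (n : ℤ) (x : (colimit (G ⋙ ev 𝒜 n) : AddCommGrpCat.{v})) :
    ∃ j y, x = colimIn G n j y := by
  obtain ⟨j, y, h⟩ := Concrete.colimit_exists_rep (G ⋙ ev 𝒜 n) x
  exact ⟨j, y, h.symm⟩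

/-- The filtered colimit of differential graded modules, computed degreewise. -/
noncomputable def filteredColimit : DGModule 𝒜 where
  X n := (colimit (G ⋙ ev 𝒜 n) : AddCommGrpCat.{v})
  smul h a := colimSmul G h a
  smul_add h a x y := map_add _ x y
  add_smul {i m n} h a b x := by
    obtain ⟨j, y, rfl⟩ := colimIn_surj G m x
    simp only [colimSmul_in, DGModule.add_smul, map_add]
  one_smul {m} x := by
    obtain ⟨j, y, rfl⟩ := colimIn_surj G m x
    simp only [colimSmul_in, DGModule.one_smul]
  mul_smul {i j m n p} h₁ h₂ h₃ a b x := by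
    obtain ⟨j, y, rfl⟩ := colimIn_surj G m x
    simp only [colimSmul_in, DGModule.mul_smul _ h₁ h₂]
  d h := colimD G h
  d_d {m n p} h₁ h₂ x := by
    obtain ⟨j, y, rfl⟩ := colimIn_surj G m x
    simp only [colimD_in, DGModule.d_d, map_zero]
  d_smul {i m n m' n'} h hm hn h' a x := by
    obtain ⟨j, y, rfl⟩ := colimIn_surj G m x
    simp only [colimD_in, colimSmul_in, DGModule.d_smul _ h hm hn h']

/-- The colimit cocone of a filtered diagram of differential graded modules. -/
noncomputable def filteredColimitCocone : Cocone G where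
  pt := filteredColimit G
  ι :=
    { app := fun j =>
        { f := fun n => colimIn G n j
          comm := fun h x => (colimD_in G h j x).symm
          map_smul := fun h a x => (colimSmul_in G h a j x).symm }
      naturality := fun _ _ f => hom_ext fun n x =>
        ConcreteCategory.congr_hom (colimit.w (G ⋙ ev 𝒜 n) f) x }

/-- The universal map out of the filtered colimit. -/
noncomputable def filteredColimitDesc (s : Cocone G) : filteredColimit G ⟶ s.pt where
  f n := colimDesc G s n
  comm {m n} h x := by
    obtain ⟨j, y, rfl⟩ := colimIn_surj G m x
    change colimDesc G s n (colimD G h _) = _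
    rw [colimD_in, colimDesc_in, (s.ι.app j).comm h y]
    exact congrArg _ (colimDesc_in G s m j y).symm
  map_smul {i m n} h a x := by
    obtain ⟨j, y, rfl⟩ := colimIn_surj G m x
    change colimDesc G s n (colimSmul G h a _) = _
    rw [colimSmul_in, colimDesc_in, (s.ι.app j).map_smul h a y]
    exact congrArg _ (colimDesc_in G s m j y).symm

/-- The degreewise colimit is a colimit. -/
noncomputable def filteredColimitIsColimit : IsColimit (filteredColimitCocone G) where
  desc s := filteredColimitDesc G s
  fac s j := hom_ext fun n z => colimDesc_in G s n j z
  uniq s m hm := hom_ext fun n x => by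
    obtain ⟨j, y, rfl⟩ := colimIn_surj G n x
    trans (s.ι.app j).f n y
    · rw [← hm]; rfl
    · exact (colimDesc_in G s n j y).symm

end FilteredColimits

/-- With this, a hypothesis on `U` with values in `dg^S` becomes a statement about the elements of
`U A` in each component and degree. -/
instance {J : Type v} [SmallCategory J] [IsFiltered J] (n : ℤ) :
    PreservesColimitsOfShape J (ev 𝒜 n) where
  preservesColimit {G} :=
    preservesColimit_of_preserves_colimit_cocone (filteredColimitIsColimit G)
      (IsColimit.ofIsoColimit (colimit.isColimit (G ⋙ ev 𝒜 n)) (Cocone.ext (Iso.refl _)))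

instance {J : Type v} [SmallCategory J] [IsFiltered J] : HasColimitsOfShape J (DGModule 𝒜) where
  has_colimit G := ⟨⟨_, filteredColimitIsColimit G⟩⟩

end DGModule

/-! ### Elements of filtered colimits in `C` -/

section Families

variable {K : Type v} [Ring K] {𝒜 : ℤ → AddSubgroup K} [GradedRing 𝒜] {S : Type v}

instance {J : Type v} [SmallCategory J] [IsFiltered J] (s : S) :
    PreservesColimitsOfShape J (Pi.eval (fun _ : S => DGModule 𝒜) s) where
  preservesColimit {G} :=
    preservesColimit_of_preserves_colimit_cocone
      (pi.coconeOfCoconeEvalIsColimit fun s => colimit.isColimit (G ⋙ Pi.eval _ s))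
      (IsColimit.ofIsoColimit (colimit.isColimit (G ⋙ Pi.eval _ s)) (Cocone.ext (Iso.refl _)))

variable {C : Type u} [Category.{v} C] (U : C ⥤ (S → DGModule 𝒜))

/-- The underlying set of the component of `U A` at `s` in degree `n`. -/
def dgEv (s : S) (n : ℤ) : C ⥤ Type v :=
  U ⋙ Pi.eval (fun _ : S => DGModule 𝒜) s ⋙ DGModule.ev 𝒜 n ⋙ forget AddCommGrpCat

instance [hU : PreservesFilteredColimits U] (s : S) (n : ℤ) :
    PreservesFilteredColimitsOfSize.{v, v} (dgEv U s n) where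
  preserves_filtered_colimits J _ _ := by
    have := hU.preserves_filtered_colimits J
    unfold dgEv
    infer_instance

/-- The hypothesis on `U` concerns diagrams in `Type v`, whereas sequences are indexed by `ℕ` in
`Type 0`; this requires a change of universe. -/
instance [PreservesFilteredColimits U] (s : S) (n : ℤ) :
    PreservesColimitsOfShape ℕ (dgEv U s n) :=
  have : PreservesFilteredColimitsOfSize.{0, 0} (dgEv U s n) :=
    preservesSmallestFilteredColimits_of_preservesFilteredColimits.{v, v} _
  inferInstance

section

universe w w'

variable {J : Type w} [Category.{w'} J] {G : J ⥤ C} {c : Cocone G}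

lemma dgEv_exists_rep {s : S} {n : ℤ} [PreservesColimitsOfShape J (dgEv U s n)]
    (hc : IsColimit c) (x : (U.obj c.pt s).X n) :
    ∃ (j : J) (y : (U.obj (G.obj j) s).X n), (U.map (c.ι.app j) s).f n y = x :=
  Types.jointly_surjective_of_isColimit (isColimitOfPreserves (dgEv U s n) hc) x

lemma dgEv_exists_of_rep_eq [IsFiltered J] {s : S} {n : ℤ} [PreservesColimitsOfShape J (dgEv U s n)]
    (hc : IsColimit c) {j : J} (x y : (U.obj (G.obj j) s).X n)
    (h : (U.map (c.ι.app j) s).f n x = (U.map (c.ι.app j) s).f n y) :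
    ∃ (k : J) (f : j ⟶ k), (U.map (G.map f) s).f n x = (U.map (G.map f) s).f n y :=
  (Types.FilteredColimit.isColimit_eq_iff' (isColimitOfPreserves (dgEv U s n) hc) x y).1 h

end

end Families

/-! ### Graded maps and graded bases -/

namespace DGModule

variable {K : Type v} [Ring K] {𝒜 : ℤ → AddSubgroup K} [GradedRing 𝒜]

lemma smul_congr (M : DGModule 𝒜) {i j m n : ℤ} (h : i + m = n) (h' : j + m = n) (a : 𝒜 i)
    (b : 𝒜 j) (e : (a : K) = b) (x : M.X m) : M.smul h a x = M.smul h' b x := by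
  obtain rfl : i = j := by omega
  rw [Subtype.ext e]

lemma smul_eq_self (M : DGModule 𝒜) {i m : ℤ} (h : i + m = m) (a : 𝒜 i) (e : (a : K) = 1)
    (x : M.X m) : M.smul h a x = x := by
  rw [M.smul_congr h (zero_add m) a ⟨1, SetLike.GradedOne.one_mem⟩ e, M.one_smul]

lemma castHom_d (M : DGModule 𝒜) {m n m' n' : ℤ} (h : m + 1 = n) (h' : m' + 1 = n') (hm : m = m')
    (hn : n = n') (x : M.X m) : M.castHom hn (M.d h x) = M.d h' (M.castHom hm x) := by
  subst hm hn; rfl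

lemma castHom_smul (M : DGModule 𝒜) {i m n m' n' : ℤ} (h : i + m = n) (h' : i + m' = n')
    (hm : m = m') (hn : n = n') (a : 𝒜 i) (x : M.X m) :
    M.castHom hn (M.smul h a x) = M.smul h' a (M.castHom hm x) := by
  subst hm hn; rfl

lemma smul_smul_eq (M : DGModule 𝒜) {i j k m n p : ℤ} (h₁ : j + m = n) (h₂ : i + n = p)
    (h₃ : k + m = p) (a : 𝒜 i) (b : 𝒜 j) (c : 𝒜 k) (e : (c : K) = a * b) (x : M.X m) :
    M.smul h₂ a (M.smul h₁ b x) = M.smul h₃ c x := by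
  rw [← M.mul_smul h₁ h₂ (by omega)]
  exact M.smul_congr _ _ _ _ e.symm x

/-- Graded `K`-linear maps of degree `k`, not necessarily compatible with the differentials. -/
structure GrHom (M N : DGModule 𝒜) (k : ℤ) where
  f : ∀ {m n : ℤ}, m + k = n → M.X m →+ N.X n
  map_smul : ∀ {i m n m' n' : ℤ} (h : m + k = m') (h₁ : i + m = n) (h₂ : n + k = n')
    (h₃ : i + m' = n') (a : 𝒜 i) (x : M.X m), f h₂ (M.smul h₁ a x) = N.smul h₃ a (f h x)

namespace GrHom

variable {M N L : DGModule 𝒜}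

lemma f_castHom {k : ℤ} (σ : GrHom M N k) {m m' n : ℤ} (e : m = m') (h : m' + k = n)
    (h' : m + k = n) (x : M.X m) : σ.f h (M.castHom e x) = σ.f h' x := by
  subst e; rfl

/-- The differential, as a graded map. -/
def diff (M : DGModule 𝒜) : GrHom M M 1 where
  f h := M.d h
  map_smul h h₁ h₂ h₃ a x := M.d_smul h₁ h h₂ h₃ a x

/-- A chain map, as a graded map. -/
def ofHom (φ : M ⟶ N) : GrHom M N 0 where
  f {m n} h := (N.castHom (by omega)).comp (φ.f m)
  map_smul {i m n m' n'} h h₁ h₂ h₃ a x := by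
    obtain rfl : m = m' := by omega
    obtain rfl : n = n' := by omega
    simp [φ.map_smul]

@[simp] lemma ofHom_f (φ : M ⟶ N) {m : ℤ} (h : m + 0 = m) (x : M.X m) :
    (ofHom φ).f h x = φ.f m x := rfl

/-- Composition of graded maps. -/
def comp {k l p : ℤ} (σ : GrHom M N k) (τ : GrHom N L l) (e : k + l = p) : GrHom M L p where
  f {m n} h := (τ.f (by omega)).comp (σ.f (rfl : m + k = m + k))
  map_smul {i m n m' n'} h h₁ h₂ h₃ a x := by
    simp only [AddMonoidHom.comp_apply]
    rw [σ.map_smul rfl h₁ rfl (by omega), τ.map_smul _ _ _ h₃]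

lemma comp_f {k l p : ℤ} (σ : GrHom M N k) (τ : GrHom N L l) (e : k + l = p) {m m' n : ℤ}
    (h : m + p = n) (h₁ : m + k = m') (h₂ : m' + l = n) (x : M.X m) :
    (σ.comp τ e).f h x = τ.f h₂ (σ.f h₁ x) := by
  subst h₁; rfl

/-- Addition of graded maps. -/
def add {k : ℤ} (σ τ : GrHom M N k) : GrHom M N k where
  f h := σ.f h + τ.f h
  map_smul h h₁ h₂ h₃ a x := by
    simp only [AddMonoidHom.add_apply]
    rw [σ.map_smul h h₁ h₂ h₃, τ.map_smul h h₁ h₂ h₃, N.smul_add]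

/-- A graded map of degree `0` commuting with the differentials is a chain map. -/
def toHom (σ : GrHom M N 0)
    (h : ∀ {m n : ℤ} (h : m + 1 = n) (x : M.X m),
      σ.f (add_zero n) (M.d h x) = N.d h (σ.f (add_zero m) x)) : M ⟶ N where
  f n := σ.f (add_zero n)
  comm := h
  map_smul h₁ a x := σ.map_smul _ h₁ _ h₁ a x

end GrHom

/-- The homogeneous elements `g i`, of degree `deg i`, form a basis of the graded module `M`. -/
structure GrBasis (M : DGModule 𝒜) {ι : Type v} (deg : ι → ℤ)
    (g : ∀ (i : ι) {n : ℤ}, deg i = n → M.X n) : Prop where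
  exists_hom : ∀ (N : DGModule 𝒜) (k : ℤ) (b : ∀ (i : ι) {n : ℤ}, deg i + k = n → N.X n),
    ∃ σ : GrHom M N k, ∀ (i : ι) {m n : ℤ} (h : deg i = m) (h' : m + k = n) (h'' : deg i + k = n),
      σ.f h' (g i h) = b i h''
  span : ∀ (W : ∀ n : ℤ, AddSubgroup (M.X n)), (∀ (i : ι) {n : ℤ} (h : deg i = n), g i h ∈ W n) →
    (∀ {i m n : ℤ} (h : i + m = n) (a : 𝒜 i) (x : M.X m), x ∈ W m → M.smul h a x ∈ W n) →
    ∀ (n : ℤ) (x : M.X n), x ∈ W n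

namespace GrBasis

variable {M N : DGModule 𝒜} {ι : Type v} {deg : ι → ℤ}
  {g : ∀ (i : ι) {n : ℤ}, deg i = n → M.X n}

/-- The elements on which two graded maps agree form subgroups stable under scalars and containing
the generators, so `span` applies. -/
lemma hom_ext (hg : GrBasis M deg g) {k : ℤ} (σ τ : GrHom M N k)
    (h : ∀ (i : ι) {m n : ℤ} (h : deg i = m) (h' : m + k = n), σ.f h' (g i h) = τ.f h' (g i h))
    {m n : ℤ} (h' : m + k = n) (x : M.X m) : σ.f h' x = τ.f h' x := by
  subst h'
  refine hg.span (fun m => AddMonoidHom.eqLocus (σ.f rfl) (τ.f rfl)) (fun i n h₁ => h i h₁ rfl)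
    (fun {i m n} h₁ a x hx => ?_) m x
  change σ.f _ _ = τ.f _ _
  rw [σ.map_smul rfl h₁ rfl (by omega), τ.map_smul rfl h₁ rfl (by omega),
    show σ.f rfl x = τ.f rfl x from hx]

/-- This absorbs the sign of the shift: the differential of `M[p]` is `(-1)^p d`, so the
differentials of generators taken in `M[p]` and in `M` differ by a unit. -/
lemma of_unit (hg : GrBasis M deg g) {deg' : ι → ℤ} {g' : ∀ (i : ι) {n : ℤ}, deg' i = n → M.X n}
    (ε : ι → ℤˣ) (hdeg : ∀ i, deg' i = deg i)
    (hgg : ∀ (i : ι) {n : ℤ} (h' : deg' i = n) (h : deg i = n), g' i h' = ((ε i : ℤˣ) : ℤ) • g i h) :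
    GrBasis M deg' g' where
  exists_hom N k b := by
    obtain ⟨σ, hσ⟩ := hg.exists_hom N k
      (fun i {n} h => ((ε i : ℤˣ) : ℤ) • b i ((hdeg i).symm ▸ h))
    refine ⟨σ, fun i m n h h' h'' => ?_⟩
    rw [hgg i h ((hdeg i) ▸ h), map_zsmul, hσ _ _ _ ((hdeg i) ▸ h''), smul_smul,
      ← Units.val_mul, Int.units_mul_self]
    exact one_zsmul _
  span W h₁ h₂ := hg.span W (fun i n h => by
    have := (W n).zsmul_mem (h₁ i ((hdeg i).trans h)) ((ε i : ℤˣ) : ℤ)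
    rwa [hgg i _ h, smul_smul, ← Units.val_mul, Int.units_mul_self, Units.val_one, one_zsmul]
      at this) h₂

lemma of_iso (hg : GrBasis M deg g) (e : M ≅ N) :
    GrBasis N deg (fun i {n} h => e.hom.f n (g i h)) where
  exists_hom L k b := by
    obtain ⟨σ, hσ⟩ := hg.exists_hom L k b
    refine ⟨(GrHom.ofHom e.inv).comp σ (zero_add k), fun i m n h h' h'' => ?_⟩
    rw [GrHom.comp_f _ _ _ h' (add_zero m) h', GrHom.ofHom_f, ← comp_f, e.hom_inv_id, id_f,
      hσ _ _ _ h'']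
  span W h₁ h₂ n x := by
    have := hg.span (fun n => (W n).comap (e.hom.f n)) h₁
      (fun h a x hx => by
        rw [AddSubgroup.mem_comap, e.hom.map_smul]
        exact h₂ _ _ _ hx) n (e.inv.f n x)
    rwa [AddSubgroup.mem_comap, ← comp_f, e.inv_hom_id, id_f] at this

lemma shift (hg : GrBasis M deg g) (p : ℤ) :
    GrBasis (M.shift p) (fun i => deg i - p)
      (fun i {n} h => g i (n := n + p) (by omega)) where
  exists_hom L k b := by
    obtain ⟨σ, hσ⟩ := hg.exists_hom L (k - p) (fun i {n} h => b i (by omega))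
    refine ⟨⟨fun {m n} h => σ.f (m := m + p) (by omega), fun h h₁ h₂ h₃ a x => ?_⟩,
      fun i m n h h' h'' => ?_⟩
    · exact σ.map_smul _ _ _ h₃ a x
    · exact hσ i _ _ (by omega)
  span W h₁ h₂ n x := by
    have := AddSubgroup.mem_iInf.1 (hg.span
      -- The only index is `n = m - p`; the infimum over all such `n` transports `W` without a cast
      -- of its type.
      (fun m => ⨅ (n : ℤ) (h : m = n + p), (W n).comap (M.castHom h))
      (fun i m h => by
        simp only [AddSubgroup.mem_iInf]
        rintro n rfl
        exact h₁ i (by omega))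
      (fun {i m m'} h a x hx => by
        simp only [AddSubgroup.mem_iInf] at hx ⊢
        rintro n rfl
        obtain ⟨n', rfl⟩ : ∃ n', m = n' + p := ⟨m - p, by omega⟩
        exact h₂ (by omega) a _ (hx n' rfl)) (n + p) x) n
    exact AddSubgroup.mem_iInf.1 this rfl

end GrBasis

section free

variable (P : ℤ → Type v)

open scoped Classical in
/-- The generators of a free module. -/
noncomputable def freeGen (q : Σ a, P a) {n : ℤ} (h : -q.1 = n) : (free 𝒜 P).X n :=
  DirectSum.of (fun q : Σ a, P a => 𝒜 (n + q.1)) q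
    ⟨1, (show 0 = n + q.1 by omega) ▸ SetLike.GradedOne.one_mem⟩

open scoped Classical in
lemma free_smul_of {i m n : ℤ} (h : i + m = n) (a : 𝒜 i) (q : Σ a, P a) (b : 𝒜 (m + q.1))
    (c : 𝒜 (n + q.1))
    (hc : (c : K) = a * b) :
    (free 𝒜 P).smul h a (DirectSum.of (fun q : Σ a, P a => 𝒜 (m + q.1)) q b) =
      DirectSum.of (fun q : Σ a, P a => 𝒜 (n + q.1)) q c := by
  have hm (q : Σ a, P a) (b : 𝒜 (m + q.1)) : (a * b : K) ∈ 𝒜 (n + q.1) := by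
    have := SetLike.GradedMul.mul_mem a.2 b.2
    rwa [show i + (m + q.1) = n + q.1 by omega] at this
  refine (DFinsupp.mapRange_single (f := fun (q : Σ a, P a) (b : 𝒜 (m + q.1)) =>
    (⟨a * b, hm q b⟩ : 𝒜 (n + q.1))) (hf := fun q => Subtype.ext (mul_zero _))).trans ?_
  exact congrArg _ (Subtype.ext hc.symm)

/-- The generator of `K[a]` lies in degree `-a`, and an element `c` of that summand is `c` times the
generator. So a graded map is forced to send it to `c` times the prescribed value. -/
lemma grBasis_free : GrBasis (free 𝒜 P) (fun q : Σ a, P a => -q.1) (fun q {_} h => freeGen P q h) where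
  exists_hom N k b := by
    classical
    let F {m n : ℤ} (h : m + k = n) : (free 𝒜 P).X m →+ N.X n :=
      DirectSum.toAddMonoid (fun q : Σ a, P a =>
        (⟨⟨fun c => N.smul (show (m + q.1) + (-q.1 + k) = n by omega) c (b q rfl), by
          simpa using N.add_smul (show (m + q.1) + (-q.1 + k) = n by omega) 0 0 (b q rfl)⟩,
          fun c c' => N.add_smul _ c c' _⟩ : 𝒜 (m + q.1) →+ N.X n))
    have hF {m n : ℤ} (h : m + k = n) (q c) :
        F h (DirectSum.of (fun q : Σ a, P a => 𝒜 (m + q.1)) q c) =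
          N.smul (show (m + q.1) + (-q.1 + k) = n by omega) c (b q rfl) :=
      DirectSum.toAddMonoid_of _ _ _
    refine ⟨⟨F, fun {i m n m' n'} h h₁ h₂ h₃ a x => ?_⟩, fun q m n h h' h'' => ?_⟩
    · change F h₂ ((free 𝒜 P).smulHom h₁ a x) = N.smulHom h₃ a (F h x)
      refine DFunLike.congr_fun (f := (F h₂).comp ((free 𝒜 P).smulHom h₁ a))
        (g := (N.smulHom h₃ a).comp (F h)) (DirectSum.addHom_ext fun q c => ?_) x
      have hm := SetLike.GradedMul.mul_mem a.2 c.2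
      rw [show i + (m + q.1) = n + q.1 by omega] at hm
      refine (congrArg (F h₂) (free_smul_of P h₁ a q c ⟨_, hm⟩ rfl)).trans ?_
      refine (hF h₂ _ _).trans (Eq.trans ?_ (congrArg (N.smul h₃ a) (hF h _ _)).symm)
      exact (N.smul_smul_eq _ _ _ _ _ _ rfl _).symm
    · subst h''
      refine (hF h' q _).trans ?_
      obtain rfl : -q.1 = m := h
      exact N.smul_eq_self _ _ rfl _
  span W h₁ h₂ n x := by
    classical
    induction x using DirectSum.induction_on with
    | zero => exact (W n).zero_mem
    | add x y hx hy => exact (W n).add_mem hx hy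
    | of q c =>
      have := h₂ (show (n + q.1) + -q.1 = n by omega) c _ (h₁ q rfl)
      rwa [freeGen, free_smul_of P _ c q _ c (mul_one _).symm] at this

end free

lemma grBasis_self (ι : Type v) [Unique ι] : GrBasis (self 𝒜) (fun _ : ι => 0)
    (fun _ {_} h => ⟨1, h ▸ SetLike.GradedOne.one_mem⟩) where
  exists_hom N k b := by
    refine ⟨⟨fun {m n} h => ⟨⟨fun (c : 𝒜 m) => N.smul h c (b default (zero_add k)),
          left_eq_add.1 ((congrArg (fun c : 𝒜 m => N.smul h c (b default (zero_add k)))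
            (add_zero 0).symm).trans (N.add_smul h 0 0 (b default (zero_add k))))⟩,
          fun c c' => N.add_smul _ c c' _⟩, fun {i m n m' n'} h h₁ h₂ h₃ a x => ?_⟩,
      fun q m n h h' h'' => ?_⟩
    · exact (N.smul_smul_eq _ _ _ _ _ _ rfl _).symm
    · subst h
      obtain rfl : k = n := by omega
      rw [Unique.eq_default q]
      exact N.smul_eq_self _ _ rfl _
  span W h₁ h₂ n x := by
    have := h₂ (add_zero n) x _ (h₁ default rfl)
    convert this
    exact Subtype.ext (mul_one _).symm

/-- The family consisting of the elements `g i` and their differentials. -/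
def withDiff (M : DGModule 𝒜) {ι : Type v} (deg : ι → ℤ)
    (g : ∀ (i : ι) {n : ℤ}, deg i = n → M.X n) :
    ∀ (i : ι ⊕ ι) {n : ℤ}, Sum.elim deg (fun i => deg i + 1) i = n → M.X n
  | .inl i, _, h => g i h
  | .inr i, _, h => M.d h (g i rfl)

lemma d_gen (M : DGModule 𝒜) {ι : Type v} {deg : ι → ℤ}
    (g : ∀ (i : ι) {n : ℤ}, deg i = n → M.X n) {i : ι} {m n l : ℤ} (h : m = deg i) (hm : m + 1 = l)
    (hn : n + 1 = l) (h' : deg i = m := h.symm) (h'' : deg i = n := by omega) :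
    M.d hm (g i h') = M.d hn (g i h'') := by
  subst h'
  obtain rfl : deg i = n := h''
  rfl

/-- The homogeneous elements `g i` and their differentials form a graded basis of `M`. -/
def DGBasis (M : DGModule 𝒜) {ι : Type v} (deg : ι → ℤ)
    (g : ∀ (i : ι) {n : ℤ}, deg i = n → M.X n) : Prop :=
  GrBasis M (Sum.elim deg (fun i => deg i + 1)) (withDiff M deg g)

lemma DGBasis.shift {M : DGModule 𝒜} {ι : Type v} {deg : ι → ℤ}
    {g : ∀ (i : ι) {n : ℤ}, deg i = n → M.X n} (hg : DGBasis M deg g) (p : ℤ) :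
    DGBasis (M.shift p) (fun i => deg i - p) (fun i {n} h => g i (n := n + p) (by omega)) := by
  refine (GrBasis.shift hg p).of_unit (Sum.elim (fun _ => 1) (fun _ => p.negOnePow)) ?_ ?_
  · rintro (i | i)
    · rfl
    · change _ - _ + 1 = _ + 1 - _
      omega
  · rintro (i | i) n h' h
    · exact (one_zsmul _).symm
    · obtain rfl : deg i - p + 1 = n := h'
      change ((p.negOnePow : ℤˣ) : ℤ) • M.d _ _ = ((p.negOnePow : ℤˣ) : ℤ) • M.d _ _
      congr 1
      exact d_gen M g (show deg i - p + p = deg i by omega) _ _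

/-! ### Cones: morphisms as homotopies -/

section cone

variable {M N B : DGModule 𝒜}

/-- The embedding of `M` in the cone of `α : M ⟶ N`, of degree `-1`. -/
def coneInl (α : M ⟶ N) : GrHom M (cone α) (-1) where
  f {m n} h := (AddMonoidHom.inl _ _).comp (M.castHom (show m = n + 1 by omega))
  map_smul {i m n m' n'} h h₁ h₂ h₃ a x := Prod.ext
    (M.castHom_smul _ _ _ _ a x) (N.smul_zero _ a).symm

lemma cone_eq (α : M ⟶ N) {n : ℤ} (x : (cone α).X n) :
    x = (coneInl α).f (show n + 1 + -1 = n by omega) x.1 + (coneInr α).f n x.2 :=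
  Prod.ext (add_zero x.1).symm (zero_add x.2).symm

lemma cone_d_inl (α : M ⟶ N) {m n l : ℤ} (h : m + -1 = n) (h₁ : n + 1 = l) (h₂ : m + 1 = l + 1)
    (x : M.X m) : (cone α).d h₁ ((coneInl α).f h x) =
      (coneInr α).f l (α.f l (M.castHom (by omega) x)) - (coneInl α).f (by omega) (M.d h₂ x) := by
  obtain rfl : m = n + 1 := by omega
  subst h₁
  refine Prod.ext ?_ ?_
  · exact (zero_sub _).symm
  · change α.f _ x + N.d _ 0 = α.f _ x - 0
    simp

/-- The map out of the cone of `α` given by `f` and a homotopy `σ`. -/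
def coneDesc (α : M ⟶ N) (f : N ⟶ B) (σ : GrHom M B (-1))
    (hσ : ∀ {m n l : ℤ} (h : m + -1 = n) (h₁ : n + 1 = m) (h₂ : m + 1 = l) (h₃ : l + -1 = m)
      (x : M.X m), B.d h₁ (σ.f h x) + σ.f h₃ (M.d h₂ x) = f.f m (α.f m x)) : cone α ⟶ B where
  f n := (σ.f (by omega)).coprod (f.f n)
  comm {m n} h x := by
    subst h
    change σ.f _ (-M.d _ _) + f.f _ (α.f _ x.1 + N.d _ x.2) = B.d _ (σ.f _ _ + f.f _ _)
    rw [map_neg, map_add, map_add, ← f.comm, ← hσ (by omega) rfl rfl (by omega) x.1]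
    abel
  map_smul {i m n} h a x := by
    refine Eq.trans ?_ (B.smul_add h a _ _).symm
    exact congrArg₂ (· + ·) (σ.map_smul (by omega) _ _ h a x.1) (f.map_smul h a x.2)

lemma coneInr_desc (α : M ⟶ N) (f : N ⟶ B) (σ : GrHom M B (-1)) (hσ) :
    coneInr α ≫ coneDesc α f σ hσ = f :=
  hom_ext fun n x => by
    change σ.f _ 0 + f.f n x = _
    rw [map_zero, zero_add]

lemma coneInl_desc (α : M ⟶ N) (f : N ⟶ B) (σ : GrHom M B (-1)) (hσ) {m n : ℤ} (h : m + -1 = n)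
    (x : M.X m) : (coneDesc α f σ hσ).f n ((coneInl α).f h x) = σ.f h x := by
  obtain rfl : m = n + 1 := by omega
  change σ.f _ x + f.f n 0 = _
  rw [map_zero, add_zero]

lemma coneHom_ext {ι : Type v} {deg : ι → ℤ} {g : ∀ (i : ι) {n : ℤ}, deg i = n → M.X n}
    (hg : GrBasis M deg g) (α : M ⟶ N) {φ ψ : cone α ⟶ B} (h : coneInr α ≫ φ = coneInr α ≫ ψ)
    (h' : ∀ i {n l : ℤ} (h₁ : deg i = n) (h₂ : n + -1 = l), φ.f l ((coneInl α).f h₂ (g i h₁)) =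
      ψ.f l ((coneInl α).f h₂ (g i h₁))) : φ = ψ := by
  refine hom_ext fun n x => ?_
  have e := hg.hom_ext ((coneInl α).comp (GrHom.ofHom φ) (add_zero _))
    ((coneInl α).comp (GrHom.ofHom ψ) (add_zero _)) (fun i m n h₁ h₂ => by
      rw [GrHom.comp_f _ _ _ _ h₂ (add_zero _), GrHom.comp_f _ _ _ _ h₂ (add_zero _)]
      exact h' i h₁ h₂) (show n + 1 + -1 = n by omega) x.1
  rw [GrHom.comp_f _ _ _ _ (by omega) (add_zero _), GrHom.comp_f _ _ _ _ (by omega) (add_zero _)]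
    at e
  rw [cone_eq α x, map_add, map_add]
  congr 1
  exact congr_arg (fun θ : N ⟶ B => θ.f n x.2) h

/-- The elements of degree one less in the cone of the identity defined by a family `g`. -/
def coneGen (N : DGModule 𝒜) {ι : Type v} {deg : ι → ℤ}
    (g : ∀ (i : ι) {n : ℤ}, deg i = n → N.X n) (i : ι) {n : ℤ} (h : deg i - 1 = n) :
    (cone (𝟙 N)).X n :=
  (coneInl (𝟙 N)).f (by omega) (g i rfl)

/-- When `N` has zero differential, `d (x, 0) = (0, x)` in the cone of the identity. The two copies
of the basis of `N` are therefore a family and its differentials. -/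
lemma dgBasis_cone {ι : Type v} {deg : ι → ℤ} {g : ∀ (i : ι) {n : ℤ}, deg i = n → N.X n}
    (hg : GrBasis N deg g) (hd : ∀ {m n : ℤ} (h : m + 1 = n) (x : N.X m), N.d h x = 0) :
    DGBasis (cone (𝟙 N)) (fun i => deg i - 1) (fun i {_} h => coneGen N g i h) := by
  have key (i : ι) {n : ℤ} (h : deg i - 1 + 1 = n) (h' : deg i = n) :
      withDiff (cone (𝟙 N)) _ (fun i {_} h => coneGen N g i h) (.inr i) h =
        (coneInr (𝟙 N)).f n (g i h') := by
    refine (cone_d_inl (𝟙 N) _ _ (show deg i + 1 = n + 1 by omega) _).trans ?_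
    rw [hd, map_zero, sub_zero, id_f]
    subst h'
    rfl
  constructor
  · intro L k b
    obtain ⟨σ, hσ⟩ := hg.exists_hom L (k - 1) (fun i {n} h => b (.inl i) (by
      change _ - 1 + _ = _; omega))
    obtain ⟨τ, hτ⟩ := hg.exists_hom L k (fun i {n} h => b (.inr i) (by
      change _ - 1 + 1 + _ = _; omega))
    refine ⟨⟨fun {m n} h => (σ.f (by omega)).coprod (τ.f h), fun h h₁ h₂ h₃ a x => ?_⟩, ?_⟩
    · refine Eq.trans ?_ (L.smul_add h₃ a _ _).symm
      exact congrArg₂ (· + ·) (σ.map_smul (by omega) _ _ h₃ a x.1) (τ.map_smul h _ h₂ h₃ a x.2)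
    · rintro (i | i) m n h h' h''
      · obtain rfl : deg i - 1 = m := h
        change σ.f _ (N.castHom _ _) + τ.f _ 0 = _
        have h₀ : deg i + (k - 1) = n := by omega
        rw [map_zero, add_zero, σ.f_castHom _ _ h₀]
        exact hσ i rfl h₀ h₀
      · have h0 : deg i = m := by change deg i - 1 + 1 = m at h; omega
        rw [key i h h0]
        change σ.f _ 0 + τ.f _ _ = _
        rw [map_zero, zero_add]
        exact hτ i h0 _ (by omega)
  · intro W h₁ h₂ n x
    rw [cone_eq _ x]
    refine (W n).add_mem ?_ ?_
    · have := hg.span (fun m => ⨅ (n : ℤ) (h : m + -1 = n), (W n).comap ((coneInl (𝟙 N)).f h))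
        (fun i m h => by
          simp only [AddSubgroup.mem_iInf]
          rintro n h'
          subst h
          exact h₁ (.inl i) (by change _ - 1 = _; omega))
        (fun {i m m'} h a x hx => by
          simp only [AddSubgroup.mem_iInf] at hx ⊢
          rintro n h'
          rw [AddSubgroup.mem_comap, (coneInl (𝟙 N)).map_smul rfl h h' (by omega)]
          exact h₂ _ a _ (hx _ rfl)) (n + 1) x.1
      simp only [AddSubgroup.mem_iInf] at this
      exact this n _
    · exact hg.span (fun m => (W m).comap ((coneInr (𝟙 N)).f m))
        (fun i m h => by
          have := h₁ (.inr i) (n := m) (by change _ - 1 + 1 = _; omega)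
          exact ((key i _ h).symm ▸ this :))
        (fun {i m m'} h a x hx => by
          rw [AddSubgroup.mem_comap, (coneInr (𝟙 N)).map_smul]
          exact h₂ _ a _ hx) n x.2

end cone

variable {M N B : DGModule 𝒜} {ι : Type v} {deg : ι → ℤ}
  {g : ∀ (i : ι) {n : ℤ}, deg i = n → M.X n}

lemma GrBasis.exists_chain (hg : GrBasis M deg g)
    (hd : ∀ {m n : ℤ} (h : m + 1 = n) (x : M.X m), M.d h x = 0)
    (b : ∀ i {n : ℤ}, deg i = n → N.X n)
    (hb : ∀ i {m n : ℤ} (h : deg i = m) (h' : m + 1 = n), N.d h' (b i h) = 0) :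
    ∃ φ : M ⟶ N, ∀ i {n : ℤ} (h : deg i = n), φ.f n (g i h) = b i h := by
  obtain ⟨σ, hσ⟩ := hg.exists_hom N 0 (fun i {n} h => b i (by omega))
  refine ⟨σ.toHom fun {m n} h x => ?_, fun i n h => hσ i h (add_zero n) (by omega)⟩
  have := hg.hom_ext ((GrHom.diff M).comp σ (add_zero 1)) (σ.comp (GrHom.diff N) (zero_add 1))
    (fun i m n h h' => by
      rw [GrHom.comp_f _ _ _ _ h' (add_zero n), GrHom.comp_f _ _ _ _ (add_zero m) h',
        hσ i h (add_zero m) (by omega)]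
      exact (congrArg _ (hd _ _)).trans ((map_zero _).trans (hb i h h').symm)) h x
  rwa [GrHom.comp_f _ _ _ _ h (add_zero n), GrHom.comp_f _ _ _ _ (add_zero m) h] at this

/-- A family of elements indexed by the generators and their differentials. -/
def sumFam (k : ℤ) (b : ∀ i {n : ℤ}, deg i + k = n → N.X n)
    (b' : ∀ i {n : ℤ}, deg i + 1 + k = n → N.X n) :
    ∀ (i : ι ⊕ ι) {n : ℤ}, Sum.elim deg (fun i => deg i + 1) i + k = n → N.X n
  | .inl i, _, h => b i h
  | .inr i, _, h => b' i h

lemma DGBasis.exists_gr (hg : DGBasis M deg g) (k : ℤ) (b : ∀ i {n : ℤ}, deg i + k = n → N.X n)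
    (b' : ∀ i {n : ℤ}, deg i + 1 + k = n → N.X n) :
    ∃ σ : GrHom M N k,
      (∀ i {m n : ℤ} (h : deg i = m) (h' : m + k = n) (h'' : deg i + k = n),
        σ.f h' (g i h) = b i h'') ∧
      (∀ i {l m n : ℤ} (h : deg i = l) (h₁ : l + 1 = m) (h' : m + k = n)
        (h'' : deg i + 1 + k = n), σ.f h' (M.d h₁ (g i h)) = b' i h'') := by
  obtain ⟨σ, hσ⟩ := hg.exists_hom N k (sumFam k b b')
  refine ⟨σ, fun i m n h h' h'' => hσ (.inl i) h h' h'', fun i l m n h h₁ h' h'' => ?_⟩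
  subst h
  exact hσ (.inr i) h₁ h' h''

lemma DGBasis.gr_ext (hg : DGBasis M deg g) {k : ℤ} (σ τ : GrHom M N k)
    (h : ∀ i {m n : ℤ} (h : deg i = m) (h' : m + k = n), σ.f h' (g i h) = τ.f h' (g i h))
    (hd : ∀ i {l m n : ℤ} (h : deg i = l) (h₁ : l + 1 = m) (h' : m + k = n),
      σ.f h' (M.d h₁ (g i h)) = τ.f h' (M.d h₁ (g i h)))
    {m n : ℤ} (h' : m + k = n) (x : M.X m) : σ.f h' x = τ.f h' x := by
  refine GrBasis.hom_ext hg σ τ ?_ h' x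
  rintro (i | i) m n h₁ h₂
  · exact h i h₁ h₂
  · exact hd i rfl h₁ h₂

lemma DGBasis.chain_ext (hg : DGBasis M deg g) {φ ψ : M ⟶ N}
    (h : ∀ i {n : ℤ} (h : deg i = n), φ.f n (g i h) = ψ.f n (g i h)) : φ = ψ := by
  refine DGModule.hom_ext fun n x => ?_
  refine hg.gr_ext (GrHom.ofHom φ) (GrHom.ofHom ψ) (fun i m n h₁ h₂ => ?_)
    (fun i l m n h₁ h₂ h₃ => ?_) (add_zero n) x
  · obtain rfl : m = n := by omega
    exact h i h₁
  · obtain rfl : m = n := by omega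
    rw [GrHom.ofHom_f, GrHom.ofHom_f, φ.comm, ψ.comm, h]

/-- The generators impose no cycle condition here, because their differentials are independent basis
elements whose images may be set to `d (b i)`. -/
lemma DGBasis.exists_chain (hg : DGBasis M deg g) (b : ∀ i {n : ℤ}, deg i = n → N.X n) :
    ∃ φ : M ⟶ N, ∀ i {n : ℤ} (h : deg i = n), φ.f n (g i h) = b i h := by
  obtain ⟨σ, hσ, hσ'⟩ := hg.exists_gr 0 (fun i {n} h => b i (by omega))
    (fun i {n} h => N.d (show deg i + 1 = n by omega) (b i rfl))
  refine ⟨σ.toHom fun {m n} h x => ?_, fun i n h => hσ i h (add_zero n) (by omega)⟩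
  have := hg.gr_ext ((GrHom.diff M).comp σ (add_zero 1)) (σ.comp (GrHom.diff N) (zero_add 1))
    (fun i m n h h' => by
      rw [GrHom.comp_f _ _ _ _ h' (add_zero n), GrHom.comp_f _ _ _ _ (add_zero _) h',
        hσ i h (add_zero _) (by omega)]
      refine (hσ' i h h' (add_zero n) (by omega)).trans ?_
      subst h
      rfl)
    (fun i l m n h h₁ h' => by
      rw [GrHom.comp_f _ _ _ _ h' (add_zero n), GrHom.comp_f _ _ _ _ (add_zero _) h',
        hσ' i h h₁ (add_zero _) (by omega)]
      change σ.f _ (M.d _ (M.d _ _)) = N.d _ (N.d _ _)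
      rw [M.d_d, N.d_d, map_zero]) h x
  rwa [GrHom.comp_f _ _ _ _ h (add_zero n), GrHom.comp_f _ _ _ _ (add_zero m) h] at this

/-- The graded map `d σ + σ d`. -/
def GrHom.boundary (σ : GrHom M B (-1)) : GrHom M B 0 :=
  (σ.comp (GrHom.diff B) (neg_add_cancel 1)).add ((GrHom.diff M).comp σ (add_neg_cancel 1))

lemma GrHom.boundary_f (σ : GrHom M B (-1)) {m n l : ℤ} (h : m + -1 = n) (h₁ : n + 1 = m)
    (h₂ : m + 1 = l) (h₃ : l + -1 = m) (x : M.X m) :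
    σ.boundary.f (add_zero m) x = B.d h₁ (σ.f h x) + σ.f h₃ (M.d h₂ x) := by
  rw [← show (GrHom.diff B).f h₁ (σ.f h x) = B.d h₁ (σ.f h x) from rfl,
    ← GrHom.comp_f σ (GrHom.diff B) (neg_add_cancel 1) (add_zero m) h h₁ x,
    ← show σ.f h₃ ((GrHom.diff M).f h₂ x) = σ.f h₃ (M.d h₂ x) from rfl,
    ← GrHom.comp_f (GrHom.diff M) σ (add_neg_cancel 1) (add_zero m) h₂ h₃ x]
  rfl

/-- The homotopy equation `dσ + σd = f α` at `g i` can be solved for `σ (d (g i))`, which is a value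
on a basis element. At `d (g i)` it then follows from `d d = 0` and from `f` and `α` being chain
maps. Hence `σ (g i)` is unconstrained. -/
lemma DGBasis.exists_coneHom (hg : DGBasis M deg g) (α : M ⟶ N) (f : N ⟶ B)
    (b : ∀ i {n : ℤ}, deg i + -1 = n → B.X n) :
    ∃ φ : cone α ⟶ B, coneInr α ≫ φ = f ∧
      ∀ i {m n : ℤ} (h : deg i = m) (h' : m + -1 = n) (h'' : deg i + -1 = n),
        φ.f n ((coneInl α).f h' (g i h)) = b i h'' := by
  obtain ⟨σ, hσ, hσ'⟩ := hg.exists_gr (-1) b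
    (fun i {n} h => f.f n (α.f n (g i (by omega))) - B.d (by omega) (b i rfl))
  refine ⟨coneDesc α f σ fun {m n l} h h₁ h₂ h₃ x => ?_, coneInr_desc _ _ _ _,
    fun i m n h h' h'' => ?_⟩
  · rw [← GrHom.boundary_f]
    refine hg.gr_ext σ.boundary (GrHom.ofHom (α ≫ f)) (fun i m n h h' => ?_)
      (fun i l m n h h₁ h₂ => ?_) (add_zero m) x
    · obtain rfl : m = n := by omega
      subst h
      rw [GrHom.boundary_f σ rfl (by omega) rfl (by omega), hσ i rfl rfl rfl,
        hσ' i rfl rfl (by omega) (by omega), add_sub_cancel]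
      rfl
    · obtain rfl : m = n := by omega
      rw [GrHom.boundary_f σ (by omega) h₁ rfl (by omega), hσ' i h h₁ (by omega) (by omega),
        M.d_d, map_zero, add_zero, map_sub, B.d_d, sub_zero, GrHom.ofHom_f, comp_f, α.comm, f.comm]
  · rw [coneInl_desc]
    exact hσ i h h' h''

/-- The formula `d (inl x) = inr (α x) - inl (d x)` determines a chain map at `inl (d (g i))` from
its values at `inl (g i)` and on `N`. -/
lemma DGBasis.coneHom_ext (hg : DGBasis M deg g) (α : M ⟶ N) {φ ψ : cone α ⟶ B}
    (h : coneInr α ≫ φ = coneInr α ≫ ψ)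
    (h' : ∀ i {n l : ℤ} (h₁ : deg i = n) (h₂ : n + -1 = l), φ.f l ((coneInl α).f h₂ (g i h₁)) =
      ψ.f l ((coneInl α).f h₂ (g i h₁))) : φ = ψ := by
  refine DGModule.coneHom_ext hg α h ?_
  rintro (i | i) n l h₁ h₂
  · exact h' i h₁ h₂
  · obtain rfl : deg i + 1 = n := h₁
    obtain rfl : l = deg i := by omega
    have e := cone_d_inl α (rfl : deg i + -1 = _) (show deg i + -1 + 1 = deg i by omega) rfl
      (g i rfl)
    rw [eq_sub_iff_add_eq, ← eq_sub_iff_add_eq'] at e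
    have hf (z : N.X (deg i)) : φ.f _ ((coneInr α).f _ z) = ψ.f _ ((coneInr α).f _ z) :=
      congrArg (fun θ : N ⟶ B => θ.f (deg i) z) h
    refine (congrArg (φ.f _) e).trans (Eq.trans ?_ (congrArg (ψ.f _) e).symm)
    rw [map_sub, map_sub, hf, φ.comm, ψ.comm, h']

/-- With zero differential on `M`, the homotopy equation reduces to `dσ = f α`, and it suffices to
impose it on the basis. -/
lemma GrBasis.exists_coneHom (hg : GrBasis M deg g)
    (hd : ∀ {m n : ℤ} (h : m + 1 = n) (x : M.X m), M.d h x = 0) (α : M ⟶ N) (f : N ⟶ B)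
    (b : ∀ i {n : ℤ}, deg i + -1 = n → B.X n)
    (hb : ∀ i {n m : ℤ} (h : deg i + -1 = n) (h' : n + 1 = m) (h'' : deg i = m),
      B.d h' (b i h) = f.f m (α.f m (g i h''))) :
    ∃ φ : cone α ⟶ B, coneInr α ≫ φ = f ∧
      ∀ i {m n : ℤ} (h : deg i = m) (h' : m + -1 = n) (h'' : deg i + -1 = n),
        φ.f n ((coneInl α).f h' (g i h)) = b i h'' := by
  obtain ⟨σ, hσ⟩ := hg.exists_hom B (-1) b
  refine ⟨coneDesc α f σ fun {m n l} h h₁ h₂ h₃ x => ?_, coneInr_desc _ _ _ _,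
    fun i m n h h' h'' => ?_⟩
  · rw [← GrHom.boundary_f]
    refine hg.hom_ext σ.boundary (GrHom.ofHom (α ≫ f)) (fun i m n h h' => ?_) (add_zero m) x
    obtain rfl : m = n := by omega
    rw [GrHom.boundary_f σ rfl (by omega) rfl (by omega), hσ i h rfl (by omega), hd, map_zero,
      add_zero, hb i (by omega) (by omega) h]
    rfl
  · rw [coneInl_desc]
    exact hσ i h h' h''

lemma dgBasis_zero (ι : Type v) [IsEmpty ι] (deg : ι → ℤ) :
    DGBasis (zero : DGModule 𝒜) deg (fun i {_} _ => isEmptyElim i) where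
  exists_hom N _ _ := ⟨⟨fun _ => 0, fun _ _ _ _ _ _ => (N.smul_zero _ _).symm⟩, fun i =>
    isEmptyElim i⟩
  span W _ _ n _ := (W n).zero_mem

end DGModule

/-! ### Extensions by generators, with or without prescribed differentials -/

section Extensions

variable {K : Type v} [Ring K] {𝒜 : ℤ → AddSubgroup K} [GradedRing 𝒜] {S : Type v}

section

variable {T : Type v} (s : T → S) (deg : T → ℤ)

variable (𝒜) in
/-- The family of free modules on generators `t : T` of degree `deg t` at `s t`. -/
noncomputable def dgFreeOn : S → DGModule 𝒜 :=
  fun x => DGModule.free 𝒜 (fun a => {t : T // s t = x ∧ -a = deg t})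

lemma dgFreeOn_isFree : DGIsFree (dgFreeOn 𝒜 s deg) := fun _ => ⟨_, ⟨Iso.refl _⟩⟩

/-- The generators of `dgFreeOn`, collected over all components, are indexed by `T`. -/
def fiberEquiv : T ≃ Σ x, Σ a, {t : T // s t = x ∧ -a = deg t} where
  toFun t := ⟨s t, -deg t, t, rfl, neg_neg _⟩
  invFun q := q.2.2.1
  left_inv _ := rfl
  right_inv := by
    rintro ⟨_, a, t, rfl, h⟩
    obtain rfl : a = -deg t := by omega
    rfl

/-- Distribution of a family indexed by `T` over the components. -/
def fiberFam {s : T → S} {deg : T → ℤ} {M : S → DGModule 𝒜}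
    (z : ∀ t {n : ℤ}, deg t = n → (M (s t)).X n) (x : S)
    (q : Σ a, {t : T // s t = x ∧ -a = deg t}) {n : ℤ} (h : -q.1 = n) : (M x).X n :=
  q.2.2.1 ▸ z q.2.1 (q.2.2.2.symm.trans h)

end

lemma DGIsFree.exists_basis {N : S → DGModule 𝒜} (hN : DGIsFree N) :
    (∃ (ι : S → Type v) (deg : ∀ x, ι x → ℤ) (g : ∀ x (i : ι x) {n : ℤ}, deg x i = n → (N x).X n),
      ∀ x, (N x).GrBasis (deg x) (g x)) ∧
    ∀ x {m n : ℤ} (h : m + 1 = n) (y : (N x).X m), (N x).d h y = 0 := by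
  choose P e using hN
  refine ⟨⟨fun x => Σ a, P x a, _, _, fun x => (DGModule.grBasis_free (P x)).of_iso (e x).some.symm⟩,
    fun x m n h y => ?_⟩
  have : y = (e x).some.inv.f m ((e x).some.hom.f m y) := by
    rw [← DGModule.comp_f, Iso.hom_inv_id, DGModule.id_f]
  rw [this, ← (e x).some.inv.comm]
  exact map_zero _

lemma DGModule.shift_d_eq_zero {M : DGModule 𝒜}
    (hd : ∀ {m n : ℤ} (h : m + 1 = n) (x : M.X m), M.d h x = 0) (p : ℤ) {m n : ℤ}
    (h : m + 1 = n) (x : (M.shift p).X m) : (M.shift p).d h x = 0 := by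
  change ((p.negOnePow : ℤˣ) : ℤ) • M.d (show m + p + 1 = n + p by omega) x = 0
  exact (congrArg _ (hd _ _)).trans (zsmul_zero _)

variable {C : Type u} [Category.{v} C] {F : (S → DGModule 𝒜) ⥤ C} {U : C ⥤ (S → DGModule 𝒜)}

lemma map_comp_f {A B D : C} (f : A ⟶ B) (g : B ⟶ D) (x : S) {n : ℤ} (y : (U.obj A x).X n) :
    (U.map (f ≫ g) x).f n y = (U.map g x).f n ((U.map f x).f n y) := by
  rw [U.map_comp]; rfl

lemma map_id_f (A : C) (x : S) {n : ℤ} (y : (U.obj A x).X n) : (U.map (𝟙 A) x).f n y = y := by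
  rw [U.map_id]; rfl

variable (U) in
/-- `j : A ⟶ D` is the extension freely generated by elements `e t` of degree `deg t` of
`U D (s t)`. -/
structure FreeExt {A D : C} (j : A ⟶ D) {T : Type v} (s : T → S) (deg : T → ℤ)
    (e : ∀ t {n : ℤ}, deg t = n → (U.obj D (s t)).X n) : Prop where
  exists_hom : ∀ {B : C} (f : A ⟶ B) (b : ∀ t {n : ℤ}, deg t = n → (U.obj B (s t)).X n),
    ∃ φ : D ⟶ B, j ≫ φ = f ∧
      ∀ t {n : ℤ} (h : deg t = n), (U.map φ (s t)).f n (e t h) = b t h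
  hom_ext : ∀ {B : C} (φ ψ : D ⟶ B), j ≫ φ = j ≫ ψ → (∀ t {n : ℤ} (h : deg t = n),
    (U.map φ (s t)).f n (e t h) = (U.map ψ (s t)).f n (e t h)) → φ = ψ

variable (U) in
/-- `j : A ⟶ D` is the extension freely generated by elements `e t` of degree `deg t` of
`U D (s t)` with differentials `z t`. -/
structure KillExt {A D : C} (j : A ⟶ D) {T : Type v} (s : T → S) (deg : T → ℤ)
    (z : ∀ t {n : ℤ}, deg t + 1 = n → (U.obj A (s t)).X n)
    (e : ∀ t {n : ℤ}, deg t = n → (U.obj D (s t)).X n) : Prop where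
  d_e : ∀ t {m n : ℤ} (h : deg t = m) (h' : m + 1 = n) (h'' : deg t + 1 = n),
    (U.obj D (s t)).d h' (e t h) = (U.map j (s t)).f n (z t h'')
  exists_hom : ∀ {B : C} (f : A ⟶ B) (b : ∀ t {n : ℤ}, deg t = n → (U.obj B (s t)).X n),
    (∀ t {m n : ℤ} (h : deg t = m) (h' : m + 1 = n) (h'' : deg t + 1 = n),
      (U.obj B (s t)).d h' (b t h) = (U.map f (s t)).f n (z t h'')) →
    ∃ φ : D ⟶ B, j ≫ φ = f ∧
      ∀ t {n : ℤ} (h : deg t = n), (U.map φ (s t)).f n (e t h) = b t h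
  hom_ext : ∀ {B : C} (φ ψ : D ⟶ B), j ≫ φ = j ≫ ψ → (∀ t {n : ℤ} (h : deg t = n),
    (U.map φ (s t)).f n (e t h) = (U.map ψ (s t)).f n (e t h)) → φ = ψ

/-- Transport of a family along a bijection of index types. -/
lemma exists_reindex {T T' : Type v} (ε : T' ≃ T) {β : T → ℤ → Type v} {deg : T → ℤ}
    {deg' : T' → ℤ} (hdeg : ∀ t, deg' t = deg (ε t))
    (b : ∀ t {n : ℤ}, deg' t = n → β (ε t) n) :
    ∃ b' : ∀ t {n : ℤ}, deg t = n → β t n,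
      ∀ t {n : ℤ} (h : deg t = n), ∀ t' (ht : t = ε t') (h' : deg' t' = n),
        b' t h = ht ▸ b t' h' := by
  refine ⟨fun t {n} h => (ε.apply_symm_apply t) ▸ b (ε.symm t) (by
    rw [hdeg, ε.apply_symm_apply, h]), fun t n h t' ht h' => ?_⟩
  subst ht
  have key (t'' : T') (ht : t'' = t') (h₁ : ε t'' = ε t') (h₂ : deg' t'' = n) :
      h₁ ▸ b t'' h₂ = b t' h' := by
    subst ht; rfl
  exact key _ (ε.symm_apply_apply t') _ _

lemma FreeExt.reindex {A D : C} {j : A ⟶ D} {T T' : Type v} {s : T → S} {deg : T → ℤ}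
    {e : ∀ t {n : ℤ}, deg t = n → (U.obj D (s t)).X n} (H : FreeExt U j s deg e) (ε : T' ≃ T)
    (deg' : T' → ℤ) (hdeg : ∀ t, deg' t = deg (ε t)) :
    FreeExt U j (s ∘ ε) deg' (fun t {_} h => e (ε t) ((hdeg t).symm.trans h)) where
  exists_hom {B} f b := by
    obtain ⟨b', hb'⟩ := exists_reindex (β := fun t n => (U.obj B (s t)).X n) ε hdeg b
    obtain ⟨φ, h₁, h₂⟩ := H.exists_hom f b'
    exact ⟨φ, h₁, fun t n h => (h₂ _ _).trans (hb' _ _ t rfl h)⟩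
  hom_ext φ ψ h₁ h₂ := H.hom_ext φ ψ h₁ fun t n h => by
    obtain ⟨t, rfl⟩ := ε.surjective t
    exact h₂ t ((hdeg t).trans h)

lemma KillExt.reindex {A D : C} {j : A ⟶ D} {T T' : Type v} {s : T → S} {deg : T → ℤ}
    {z : ∀ t {n : ℤ}, deg t + 1 = n → (U.obj A (s t)).X n}
    {e : ∀ t {n : ℤ}, deg t = n → (U.obj D (s t)).X n} (H : KillExt U j s deg z e) (ε : T' ≃ T)
    (deg' : T' → ℤ) (hdeg : ∀ t, deg' t = deg (ε t)) :
    KillExt U j (s ∘ ε) deg' (fun t {_} h => z (ε t) ((congrArg (· + 1) (hdeg t)).symm.trans h))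
      (fun t {_} h => e (ε t) ((hdeg t).symm.trans h)) where
  d_e t m n h h' h'' := H.d_e _ _ _ _
  exists_hom {B} f b hb := by
    obtain ⟨b', hb'⟩ := exists_reindex (β := fun t n => (U.obj B (s t)).X n) ε hdeg b
    obtain ⟨φ, h₁, h₂⟩ := H.exists_hom f b' fun t m n h h' h'' => by
      obtain ⟨t, rfl⟩ := ε.surjective t
      rw [hb' _ h t rfl ((hdeg t).trans h)]
      exact hb t ((hdeg t).trans h) h' ((congrArg (· + 1) (hdeg t)).trans h'')
    exact ⟨φ, h₁, fun t n h => (h₂ _ _).trans (hb' _ _ t rfl h)⟩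
  hom_ext φ ψ h₁ h₂ := H.hom_ext φ ψ h₁ fun t n h => by
    obtain ⟨t, rfl⟩ := ε.surjective t
    exact h₂ t ((hdeg t).trans h)

lemma FreeExt.exists_iso {A D D' : C} {j : A ⟶ D} {j' : A ⟶ D'} {T : Type v} {s : T → S}
    {deg : T → ℤ} {e : ∀ t {n : ℤ}, deg t = n → (U.obj D (s t)).X n}
    {e' : ∀ t {n : ℤ}, deg t = n → (U.obj D' (s t)).X n} (H : FreeExt U j s deg e)
    (H' : FreeExt U j' s deg e') : ∃ φ : D ≅ D', j ≫ φ.hom = j' := by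
  obtain ⟨φ, h₁, h₂⟩ := H.exists_hom j' e'
  obtain ⟨ψ, h₃, h₄⟩ := H'.exists_hom j e
  refine ⟨⟨φ, ψ, H.hom_ext _ _ ?_ ?_, H'.hom_ext _ _ ?_ ?_⟩, h₁⟩
  · rw [← Category.assoc, h₁, h₃, Category.comp_id]
  · intro t n h
    rw [map_comp_f, h₂, h₄, map_id_f]
  · rw [← Category.assoc, h₃, h₁, Category.comp_id]
  · intro t n h
    rw [map_comp_f, h₄, h₂, map_id_f]

/-- The generators of the composition of a free extension with a free extension on one element. -/
def optionFam {D E : C} (k : D ⟶ E) {T : Type v} {s : Option T → S} {deg : Option T → ℤ}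
    (e : ∀ t {n : ℤ}, deg (some t) = n → (U.obj D (s (some t))).X n)
    (e' : ∀ (_ : PUnit.{v + 1}) {n : ℤ}, deg none = n → (U.obj E (s none)).X n) :
    ∀ (t : Option T) {n : ℤ}, deg t = n → (U.obj E (s t)).X n
  | none, _, h => e' ⟨⟩ h
  | some t, _, h => (U.map k (s (some t))).f _ (e t h)

lemma FreeExt.comp_option {A D E : C} {j : A ⟶ D} {k : D ⟶ E} {T : Type v} {s : Option T → S}
    {deg : Option T → ℤ} {e : ∀ t {n : ℤ}, deg (some t) = n → (U.obj D (s (some t))).X n}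
    {e' : ∀ (_ : PUnit.{v + 1}) {n : ℤ}, deg none = n → (U.obj E (s none)).X n}
    (H : FreeExt U j (s ∘ some) (deg ∘ some) e)
    (H' : FreeExt U k (fun _ => s none) (fun _ => deg none) e') :
    FreeExt U (j ≫ k) s deg (optionFam k e e') where
  exists_hom f b := by
    obtain ⟨φ, h₁, h₂⟩ := H.exists_hom f (fun t => b (some t))
    obtain ⟨ψ, h₃, h₄⟩ := H'.exists_hom φ (fun _ => b none)
    refine ⟨ψ, by rw [Category.assoc, h₃, h₁], ?_⟩
    rintro (_ | t) n h
    · exact h₄ ⟨⟩ h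
    · refine (map_comp_f _ _ _ _).symm.trans ?_
      rw [h₃]
      exact h₂ t h
  hom_ext φ ψ h₁ h₂ := by
    refine H'.hom_ext _ _ (H.hom_ext _ _ (by simpa using h₁) fun t n h => ?_)
      fun _ n h => h₂ none h
    rw [map_comp_f, map_comp_f]
    exact h₂ (some t) h

/-! ### The extensions `A⟨M, α⟩` in terms of generators -/

section Killing

variable (adj : F ⊣ U) {A D : C} {M : S → DGModule 𝒜} {α : M ⟶ U.obj A} {j : A ⟶ D}

lemma IsKilling.of_iso {adj : F ⊣ U} (H : IsKilling adj α j) {D' : C} (φ : D ≅ D') :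
    IsKilling adj α (j ≫ φ.hom) := by
  obtain ⟨g, hg⟩ := H
  exact ⟨g ≫ φ.hom, hg.of_iso (Iso.refl _) (Iso.refl _) (Iso.refl _) φ
    (by simp) (by simp) (by simp) (by simp)⟩

lemma exists_isKilling [HasColimits C] (α : M ⟶ U.obj A) :
    ∃ (D : C) (j : A ⟶ D), IsKilling adj α j :=
  ⟨_, _, _, IsPushout.of_hasPushout _ _⟩

/-- This is the pushout property transported through the adjunction: `τ` is the adjunct of `F (Cone
α) ⟶ D`, and the counit of `A` followed by `f` has adjunct `U f`. -/
lemma IsKilling.exists_cone {adj : F ⊣ U} (H : IsKilling adj α j) :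
    ∃ τ : dgCone α ⟶ U.obj D, dgConeInr α ≫ τ = U.map j ∧
      (∀ {B : C} (f : A ⟶ B) (h : dgCone α ⟶ U.obj B), dgConeInr α ≫ h = U.map f →
        ∃ φ : D ⟶ B, j ≫ φ = f ∧ τ ≫ U.map φ = h) ∧
      ∀ {B : C} (φ ψ : D ⟶ B), j ≫ φ = j ≫ ψ → τ ≫ U.map φ = τ ≫ U.map ψ → φ = ψ := by
  obtain ⟨g, hg⟩ := H
  have hc {B : C} (f : A ⟶ B) : adj.homEquiv _ _ (adj.counit.app A ≫ f) = U.map f := by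
    simp [Adjunction.homEquiv_unit]
  refine ⟨adj.homEquiv _ _ g, ?_, fun {B} f h hh => ?_, fun {B} φ ψ h₁ h₂ => ?_⟩
  · rw [← adj.homEquiv_naturality_left, ← hg.w, hc]
  · refine ⟨hg.desc f ((adj.homEquiv _ _).symm h) ?_, hg.inl_desc _ _ _, ?_⟩
    · apply (adj.homEquiv _ _).injective
      rw [hc, adj.homEquiv_naturality_left, Equiv.apply_symm_apply, hh]
    · rw [← adj.homEquiv_naturality_right, hg.inr_desc, Equiv.apply_symm_apply]
  · rw [← adj.homEquiv_naturality_right, ← adj.homEquiv_naturality_right] at h₂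
    exact hg.hom_ext h₁ ((adj.homEquiv _ _).injective h₂)

/-- The degrees drop by one because `M` enters the cone as `M[1]`. The morphism `α` leaves no trace
in the universal property. -/
lemma IsKilling.exists_freeExt {adj : F ⊣ U} (H : IsKilling adj α j) {ι : S → Type v}
    {deg : ∀ x, ι x → ℤ} {g : ∀ x (i : ι x) {n : ℤ}, deg x i = n → (M x).X n}
    (hg : ∀ x, (M x).DGBasis (deg x) (g x)) :
    ∃ e, FreeExt U j (fun t : Σ x, ι x => t.1) (fun t => deg t.1 t.2 + -1) e := by
  obtain ⟨τ, hτ, hex, hext⟩ := H.exists_cone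
  refine ⟨fun t {n} h => (τ t.1).f n ((DGModule.coneInl (α t.1)).f h (g t.1 t.2 rfl)),
    fun {B} f b => ?_, fun {B} φ ψ h₁ h₂ => ?_⟩
  · choose h hh hh' using fun x => (hg x).exists_coneHom (α x) (U.map f x) (fun i => b ⟨x, i⟩)
    obtain ⟨φ, h₁, h₂⟩ := hex f h (funext hh)
    refine ⟨φ, h₁, fun t n ht => ?_⟩
    rw [← hh' t.1 t.2 rfl ht ht, ← h₂]
    rfl
  · refine hext φ ψ h₁ (funext fun x => (hg x).coneHom_ext (α x) ?_ fun i n l hi hl => ?_)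
    · have := congrArg U.map h₁
      rw [U.map_comp, U.map_comp, ← hτ, Category.assoc, Category.assoc] at this
      exact congrFun this x
    · subst hi
      exact h₂ ⟨x, i⟩ hl

lemma IsKilling.exists_killExt {adj : F ⊣ U} (H : IsKilling adj α j) {ι : S → Type v}
    {deg : ∀ x, ι x → ℤ} {g : ∀ x (i : ι x) {n : ℤ}, deg x i = n → (M x).X n}
    (hg : ∀ x, (M x).GrBasis (deg x) (g x))
    (hd : ∀ x {m n : ℤ} (h : m + 1 = n) (y : (M x).X m), (M x).d h y = 0) :
    ∃ e, KillExt U j (fun t : Σ x, ι x => t.1) (fun t => deg t.1 t.2 + -1)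
      (fun t {n} h => (α t.1).f n (g t.1 t.2 (by omega))) e := by
  obtain ⟨τ, hτ, hex, hext⟩ := H.exists_cone
  refine ⟨fun t {n} h => (τ t.1).f n ((DGModule.coneInl (α t.1)).f h (g t.1 t.2 rfl)),
    fun t {m n} h h' h'' => ?_, fun {B} f b hb => ?_, fun {B} φ ψ h₁ h₂ => ?_⟩
  · have hn : deg t.1 t.2 = n := by omega
    subst hn
    refine ((τ t.1).comm h' _).symm.trans ?_
    refine (congrArg ((τ t.1).f _) (DGModule.cone_d_inl (α t.1) h h' rfl _)).trans ?_
    rw [hd, map_zero, sub_zero, ← hτ]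
    rfl
  · choose h hh hh' using fun x => (hg x).exists_coneHom (hd x) (α x) (U.map f x)
      (fun i => b ⟨x, i⟩) (fun i {n m} h h' h'' => hb ⟨x, i⟩ h h' (by
        change deg x i + -1 + 1 = m
        omega))
    obtain ⟨φ, h₁, h₂⟩ := hex f h (funext hh)
    refine ⟨φ, h₁, fun t n ht => ?_⟩
    rw [← hh' t.1 t.2 rfl ht ht, ← h₂]
    rfl
  · refine hext φ ψ h₁ (funext fun x => DGModule.coneHom_ext (hg x) (α x) ?_ fun i n l hi hl => ?_)
    · have := congrArg U.map h₁
      rw [U.map_comp, U.map_comp, ← hτ, Category.assoc, Category.assoc] at this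
      exact congrFun this x
    · subst hi
      exact h₂ ⟨x, i⟩ hl

lemma elementaryStandardCofibrations.exists_killExt {adj : F ⊣ U}
    (H : elementaryStandardCofibrations adj j) :
    ∃ (T : Type v) (s : T → S) (deg : T → ℤ)
      (z : ∀ t {n : ℤ}, deg t + 1 = n → (U.obj A (s t)).X n)
      (e : ∀ t {n : ℤ}, deg t = n → (U.obj D (s t)).X n), KillExt U j s deg z e ∧
      ∀ t {m n : ℤ} (h : deg t + 1 = m) (h' : m + 1 = n), (U.obj A (s t)).d h' (z t h) = 0 := by
  obtain ⟨M, α, hM, H⟩ := H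
  obtain ⟨⟨ι, deg, g, hg⟩, hd⟩ := hM.exists_basis
  obtain ⟨e, he⟩ := H.exists_killExt hg hd
  refine ⟨_, _, _, _, e, he, fun t m n h h' => ?_⟩
  rw [← (α t.1).comm, hd, map_zero]

/-- Take `M` free on generators of degree `deg t + 1`, which yield elements of degree `deg t` in the
cone, and let `α` send them to the `z t`. This is a chain map exactly because the `z t` are cycles.
-/
lemma exists_elementaryStandardCofibration [HasColimits C] (A : C) {T : Type v} (s : T → S)
    (deg : T → ℤ) (z : ∀ t {n : ℤ}, deg t + 1 = n → (U.obj A (s t)).X n)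
    (hz : ∀ t {m n : ℤ} (h : deg t + 1 = m) (h' : m + 1 = n),
      (U.obj A (s t)).d h' (z t h) = 0) :
    ∃ (D : C) (j : A ⟶ D) (e : ∀ t {n : ℤ}, deg t = n → (U.obj D (s t)).X n),
      elementaryStandardCofibrations adj j ∧ KillExt U j s deg z e := by
  have hfree := dgFreeOn_isFree (𝒜 := 𝒜) s (fun t => deg t + 1)
  have hg (x : S) := DGModule.grBasis_free (𝒜 := 𝒜) (fun a => {t : T // s t = x ∧ -a = deg t + 1})
  have hd := hfree.exists_basis.2
  choose α hα using fun x => (hg x).exists_chain (N := U.obj A x) (hd x)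
    (fun i {n} h => fiberFam (M := U.obj A) (deg := fun t => deg t + 1) z x i h)
    (by
      rintro ⟨a, t, rfl, h₁⟩ m n h h'
      exact hz t (h₁.symm.trans h) h')
  obtain ⟨D, j, hj⟩ := exists_isKilling (M := dgFreeOn 𝒜 s (fun t => deg t + 1)) adj α
  obtain ⟨e, he⟩ := hj.exists_killExt hg hd
  -- Rewriting `z` as the values of `α` on generators gives it the form in which the universal
  -- property of `A⟨M, α⟩` is available.
  have hz' : z = fun t {n} h => (α (s t)).f n (DGModule.freeGen _
      ⟨-(deg t + 1), t, rfl, neg_neg _⟩ (by change - -(deg t + 1) = n; omega)) := by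
    funext t n h
    exact (hα (s t) ⟨-(deg t + 1), t, rfl, neg_neg _⟩ (by change - -(deg t + 1) = _; omega)).symm
  obtain ⟨e', he'⟩ : ∃ e', KillExt U j s deg z e' := by
    rw [hz']
    exact ⟨_, he.reindex (fiberEquiv s (fun t => deg t + 1)) deg (fun t => by
      change _ = - -(deg t + 1) + -1; omega)⟩
  exact ⟨D, j, e', ⟨_, α, hfree, hj⟩, he'⟩

lemma standardTrivialCofibrations.exists_freeExt {adj : F ⊣ U}
    (H : standardTrivialCofibrations adj j) :
    ∃ (T : Type v) (s : T → S) (deg : T → ℤ)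
      (e : ∀ t {n : ℤ}, deg t = n → (U.obj D (s t)).X n), FreeExt U j s deg e := by
  obtain ⟨N, α, hN, H⟩ := H
  obtain ⟨⟨ι, deg, g, hg⟩, hd⟩ := hN.exists_basis
  obtain ⟨e, he⟩ := H.exists_freeExt (fun x => DGModule.dgBasis_cone ((hg x).shift (-1))
    (DGModule.shift_d_eq_zero (hd x) (-1)))
  exact ⟨_, _, _, e, he⟩

lemma exists_dgBasis_cone_dgFreeOn {T : Type v} (s : T → S) (deg : T → ℤ) :
    ∃ g : ∀ (x : S) (i : Σ a, {t : T // s t = x ∧ -a = deg t}) {n : ℤ}, -i.1 - -1 - 1 = n →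
      (dgCone (𝟙 (dgShift (dgFreeOn 𝒜 s deg) (-1))) x).X n,
    ∀ x, (dgCone (𝟙 (dgShift (dgFreeOn 𝒜 s deg) (-1))) x).DGBasis
      (fun i : Σ a, {t : T // s t = x ∧ -a = deg t} => -i.1 - -1 - 1) (g x) :=
  ⟨_, fun x => DGModule.dgBasis_cone ((DGModule.grBasis_free (𝒜 := 𝒜)
    (fun a => {t : T // s t = x ∧ -a = deg t})).shift (-1)) (DGModule.shift_d_eq_zero
      ((dgFreeOn_isFree (𝒜 := 𝒜) s deg).exists_basis.2 x) (-1))⟩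

/-- Any attaching map gives the same free extension, so zero is taken. Starting from degree `deg t +
1`, the shift by `-1` adds one, the cone of the identity subtracts one, and the cone of `α`
subtracts one more. -/
lemma exists_standardTrivialCofibration [HasColimits C] (A : C) {T : Type v} (s : T → S)
    (deg : T → ℤ) :
    ∃ (D : C) (j : A ⟶ D) (e : ∀ t {n : ℤ}, deg t = n → (U.obj D (s t)).X n),
      standardTrivialCofibrations adj j ∧ FreeExt U j s deg e := by
  obtain ⟨D, j, hj⟩ := exists_isKilling adj
    (dgZero (dgCone (𝟙 (dgShift (dgFreeOn 𝒜 s (fun t => deg t + 1)) (-1)))) (U.obj A))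
  obtain ⟨g, hg⟩ := exists_dgBasis_cone_dgFreeOn (𝒜 := 𝒜) s (fun t => deg t + 1)
  obtain ⟨e, he⟩ := hj.exists_freeExt hg
  exact ⟨D, j, _, ⟨_, _, dgFreeOn_isFree s _, hj⟩,
    he.reindex (fiberEquiv s (fun t => deg t + 1)) deg (fun t => by
      change _ = - -(deg t + 1) - -1 - 1 + -1; omega)⟩

/-- The cone of the zero map is `M[1] ⊕ U A` as a differential graded module: the sign of the
differential in the first summand is that of the shift. A map from it extending `U f` is thus an
independent map from `M[1]`. -/
lemma IsKilling.exists_isColimit {adj : F ⊣ U} (H : IsKilling adj (dgZero M (U.obj A)) j) :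
    ∃ i : F.obj (dgShift M 1) ⟶ D, Nonempty (IsColimit (BinaryCofan.mk i j)) := by
  obtain ⟨τ, hτ, hex, hext⟩ := H.exists_cone
  let inl : dgShift M 1 ⟶ dgCone (dgZero M (U.obj A)) := fun x =>
    { f := fun n => AddMonoidHom.inl _ _
      comm := fun {m n} h y => Prod.ext
        (by
          change ((Int.negOnePow 1 : ℤˣ) : ℤ) • (M x).d _ y = -(M x).d _ y
          simp)
        (by
          change 0 = 0 + (U.obj A x).d _ 0
          simp)
      map_smul := fun {i m n} h a y => Prod.ext rfl ((U.obj A x).smul_zero h a).symm }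
  have hadd (x : S) {n : ℤ} (y : (dgCone (dgZero M (U.obj A)) x).X n) :
      y = (inl x).f n y.1 + (dgConeInr (dgZero M (U.obj A)) x).f n y.2 :=
    Prod.ext (add_zero y.1).symm (zero_add y.2).symm
  have hi {B : C} (φ : D ⟶ B) :
      adj.homEquiv _ _ ((adj.homEquiv _ _).symm (inl ≫ τ) ≫ φ) = inl ≫ τ ≫ U.map φ := by
    rw [adj.homEquiv_naturality_right, Equiv.apply_symm_apply, Category.assoc]
  have hex' {B : C} (a : F.obj (dgShift M 1) ⟶ B) (f : A ⟶ B) :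
      ∃ φ : D ⟶ B, (adj.homEquiv _ _).symm (inl ≫ τ) ≫ φ = a ∧ j ≫ φ = f := by
    let h : dgCone (dgZero M (U.obj A)) ⟶ U.obj B := fun x =>
      { f := fun n => ((adj.homEquiv _ _ a x).f n).coprod ((U.map f x).f n)
        comm := fun {m n} h y => by
          have h₁ := (adj.homEquiv _ _ a x).comm h y.1
          have h₂ : -(M x).d (show m + 1 + 1 = n + 1 by omega) y.1 = (dgShift M 1 x).d h y.1 := by
            change _ = ((Int.negOnePow 1 : ℤˣ) : ℤ) • (M x).d _ y.1
            simp
          refine Eq.trans ?_ (map_add ((U.obj B x).d h) ((adj.homEquiv _ _ a x).f m y.1)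
            ((U.map f x).f m y.2)).symm
          exact congrArg₂ (· + ·) (Eq.trans (congrArg _ h₂) h₁)
            (Eq.trans (congrArg _ (zero_add _)) ((U.map f x).comm h y.2))
        map_smul := fun {i m n} h a' y =>
          (congrArg₂ (· + ·) ((adj.homEquiv _ _ a x).map_smul h a' y.1)
            ((U.map f x).map_smul h a' y.2)).trans ((U.obj B x).smul_add h a' _ _).symm }
    obtain ⟨φ, h₁, h₂⟩ := hex f h (funext fun x => DGModule.hom_ext fun n y => by
      change (adj.homEquiv _ _ a x).f n 0 + (U.map f x).f n y = _
      rw [map_zero, zero_add])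
    refine ⟨φ, (adj.homEquiv _ _).injective ?_, h₁⟩
    rw [hi, h₂]
    refine funext fun x => DGModule.hom_ext fun n y => ?_
    change (adj.homEquiv _ _ a x).f n y + (U.map f x).f n 0 = _
    rw [map_zero, add_zero]
  refine ⟨(adj.homEquiv _ _).symm (inl ≫ τ), ⟨BinaryCofan.isColimitMk
    (fun c => (hex' c.inl c.inr).choose) (fun c => (hex' c.inl c.inr).choose_spec.1)
    (fun c => (hex' c.inl c.inr).choose_spec.2) (fun c m h₁ h₂ => ?_)⟩⟩
  refine hext _ _ (h₂.trans (hex' c.inl c.inr).choose_spec.2.symm) (funext fun x =>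
    DGModule.hom_ext fun n y => ?_)
  have e₁ := congrArg (adj.homEquiv _ _) (h₁.trans (hex' c.inl c.inr).choose_spec.1.symm)
  have e₂ := congrArg U.map (h₂.trans (hex' c.inl c.inr).choose_spec.2.symm)
  rw [hi, hi] at e₁
  rw [U.map_comp, U.map_comp, ← hτ, Category.assoc, Category.assoc] at e₂
  rw [hadd x y, map_add, map_add]
  exact congrArg₂ (· + ·) (congrArg (fun θ : dgShift M 1 ⟶ U.obj c.pt => (θ x).f n y.1) e₁)
    (congrArg (fun θ : U.obj A ⟶ U.obj c.pt => (θ x).f n y.2) e₂)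

lemma exists_freeExt_of_isColimit {adj : F ⊣ U} {i : F.obj M ⟶ D}
    (hc : IsColimit (BinaryCofan.mk i j)) {ι : S → Type v}
    {deg : ∀ x, ι x → ℤ} {g : ∀ x (i : ι x) {n : ℤ}, deg x i = n → (M x).X n}
    (hg : ∀ x, (M x).DGBasis (deg x) (g x)) :
    ∃ e, FreeExt U j (fun t : Σ x, ι x => t.1) (fun t => deg t.1 t.2) e := by
  refine ⟨fun t {n} h => (adj.homEquiv _ _ i t.1).f n (g t.1 t.2 h), fun {B} f b => ?_,
    fun {B} φ ψ h₁ h₂ => ?_⟩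
  · choose h hh using fun x => (hg x).exists_chain (N := U.obj B x) (fun i => b ⟨x, i⟩)
    obtain ⟨φ, h₁, h₂⟩ : ∃ φ : D ⟶ B, i ≫ φ = (adj.homEquiv _ _).symm h ∧ j ≫ φ = f :=
      ⟨hc.desc (BinaryCofan.mk _ f), hc.fac _ ⟨.left⟩, hc.fac _ ⟨.right⟩⟩
    refine ⟨φ, h₂, fun t n ht => ?_⟩
    rw [← hh t.1 t.2 ht]
    have h₃ := congrArg (adj.homEquiv _ _) h₁
    rw [adj.homEquiv_naturality_right, Equiv.apply_symm_apply] at h₃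
    exact congrArg (fun θ : M ⟶ U.obj B => (θ t.1).f n (g t.1 t.2 ht)) h₃
  · refine BinaryCofan.IsColimit.hom_ext hc ((adj.homEquiv _ _).injective ?_) h₁
    change adj.homEquiv _ _ (i ≫ φ) = adj.homEquiv _ _ (i ≫ ψ)
    rw [adj.homEquiv_naturality_right, adj.homEquiv_naturality_right]
    exact funext fun x => (hg x).chain_ext fun i n h => h₂ ⟨x, i⟩ h

end Killing

end Extensions

/-! ### Quasi-isomorphisms in terms of elements -/

namespace DGModule

variable {K : Type v} [Ring K] {𝒜 : ℤ → AddSubgroup K} [GradedRing 𝒜] {M N L : DGModule 𝒜}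

lemma cohomologyMap_comp (φ : M ⟶ N) (ψ : N ⟶ L) (n : ℤ) :
    ⇑(cohomologyMap (φ ≫ ψ) n) = cohomologyMap ψ n ∘ cohomologyMap φ n := by
  funext x
  obtain ⟨x, rfl⟩ := QuotientAddGroup.mk_surjective x
  rfl

lemma cohomologyMap_id (n : ℤ) : ⇑(cohomologyMap (𝟙 M) n) = id := by
  funext x
  obtain ⟨x, rfl⟩ := QuotientAddGroup.mk_surjective x
  rfl

lemma isQuasiIso_of_iso (e : M ≅ N) : IsQuasiIso e.hom := fun n => by
  refine Function.bijective_iff_has_inverse.2 ⟨cohomologyMap e.inv n, ?_, ?_⟩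
  · rw [Function.leftInverse_iff_comp, ← cohomologyMap_comp, e.hom_inv_id, cohomologyMap_id]
  · rw [Function.rightInverse_iff_comp, ← cohomologyMap_comp, e.inv_hom_id, cohomologyMap_id]

lemma isQuasiIso_iff (φ : M ⟶ N) : IsQuasiIso φ ↔
    (∀ {l m n : ℤ} (h : l + 1 = m) (h' : m + 1 = n) (x : M.X m) (y : N.X l), M.d h' x = 0 →
      φ.f m x = N.d h y → ∃ w : M.X l, M.d h w = x) ∧
    (∀ {l m n : ℤ} (h : l + 1 = m) (h' : m + 1 = n) (y : N.X m), N.d h' y = 0 →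
      ∃ (x : M.X m) (w : N.X l), M.d h' x = 0 ∧ φ.f m x = y + N.d h w) := by
  constructor
  · intro H
    refine ⟨fun {l m n} h h' x y hx hy => ?_, fun {l m n} h h' y hy => ?_⟩
    · obtain rfl : l = m - 1 := by omega
      subst h'
      have h₁ : cohomologyMap φ m (QuotientAddGroup.mk ⟨x, hx⟩) = cohomologyMap φ m 0 := by
        rw [map_zero]
        exact (QuotientAddGroup.eq_zero_iff _).2 ⟨y, hy.symm⟩
      exact (QuotientAddGroup.eq_zero_iff _).1 ((H m).1 h₁)
    · obtain rfl : l = m - 1 := by omega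
      subst h'
      obtain ⟨x, hx⟩ := (H m).2 (QuotientAddGroup.mk ⟨y, hy⟩)
      obtain ⟨⟨x, hx'⟩, rfl⟩ := QuotientAddGroup.mk_surjective x
      obtain ⟨w, hw⟩ := QuotientAddGroup.eq.1 hx.symm
      exact ⟨x, w, hx', eq_add_of_neg_add_eq hw.symm⟩
  · rintro ⟨H₁, H₂⟩ m
    constructor
    · rw [injective_iff_map_eq_zero]
      intro x hx
      obtain ⟨⟨x, hx'⟩, rfl⟩ := QuotientAddGroup.mk_surjective x
      obtain ⟨y, hy⟩ := (QuotientAddGroup.eq_zero_iff _).1 hx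
      exact (QuotientAddGroup.eq_zero_iff _).2 (H₁ (sub_add_cancel m 1) rfl x y hx' hy.symm)
    · intro y
      obtain ⟨⟨y, hy⟩, rfl⟩ := QuotientAddGroup.mk_surjective y
      obtain ⟨x, w, hx, hw⟩ := H₂ (sub_add_cancel m 1) rfl y hy
      have : N.d (sub_add_cancel m 1) w = -y + φ.f m x := by rw [hw, neg_add_cancel_left]
      refine ⟨QuotientAddGroup.mk ⟨x, hx⟩, Eq.symm (QuotientAddGroup.eq.2 ?_)⟩
      exact ⟨w, this⟩

/-- The lifting property characterizing surjective quasi-isomorphisms. -/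
def LiftsBoundaries (φ : M ⟶ N) : Prop :=
  ∀ {m n p : ℤ} (h : m + 1 = n) (h' : n + 1 = p) (z : M.X n) (y : N.X m), M.d h' z = 0 →
    φ.f n z = N.d h y → ∃ x : M.X m, M.d h x = z ∧ φ.f m x = y

/-- The case `z = 0` lifts cycles to cycles. To lift an arbitrary `y`, first lift the cycle `d y` to
a cycle `z`, then apply the property to `z` and `y`; surjectivity follows. The two cohomological
conditions are also special cases. -/
lemma liftsBoundaries_iff (φ : M ⟶ N) :
    LiftsBoundaries φ ↔ (∀ n, Function.Surjective (φ.f n)) ∧ IsQuasiIso φ := by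
  rw [isQuasiIso_iff]
  constructor
  · intro H
    have hcyc {m n : ℤ} (h : m + 1 = n) (y : N.X m) (hy : N.d h y = 0) :
        ∃ x : M.X m, M.d h x = 0 ∧ φ.f m x = y :=
      H h rfl 0 y (map_zero _) (by rw [map_zero, hy])
    refine ⟨fun m y => ?_, fun {l m n} h h' x y hx hy => ?_, fun {l m n} h h' y hy => ?_⟩
    · obtain ⟨z, hz, hz'⟩ := hcyc rfl (N.d rfl y) (N.d_d (rfl : m + 1 = m + 1) rfl y)
      obtain ⟨x, -, hx⟩ := H rfl rfl z y hz hz'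
      exact ⟨x, hx⟩
    · obtain ⟨w, hw, -⟩ := H h h' x y hx hy
      exact ⟨w, hw⟩
    · obtain ⟨x, hx, hx'⟩ := hcyc h' y hy
      exact ⟨x, 0, hx, by rw [hx', map_zero, add_zero]⟩
  · rintro ⟨Hs, H₁, H₂⟩ m n p h h' z y hz hy
    obtain ⟨w, hw⟩ := H₁ h h' z y hz hy
    -- The primitive `w` of `z` need not map to `y`. The error `y - φ w` is a cycle, hence the image
    -- of a cycle `c` up to a boundary, and surjectivity lifts a primitive of that boundary.
    obtain ⟨c, v, hc, hv⟩ := H₂ (sub_add_cancel m 1) h (y - φ.f m w)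
      (by rw [map_sub, ← φ.comm, hw, hy, sub_self])
    obtain ⟨v, rfl⟩ := Hs _ v
    refine ⟨w + c - M.d (sub_add_cancel m 1) v, by rw [map_sub, map_add, hw, hc, M.d_d, add_zero, sub_zero], ?_⟩
    rw [map_sub, map_add, hv, φ.comm]
    abel

end DGModule

/-! ### Adjoining free generators is a weak equivalence -/

section WeakEquivalences

variable {K : Type v} [Ring K] {𝒜 : ℤ → AddSubgroup K} [GradedRing 𝒜] {S : Type v}
variable {C : Type u} [Category.{v} C] {F : (S → DGModule 𝒜) ⥤ C} {U : C ⥤ (S → DGModule 𝒜)}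

lemma cohomologyMap_map_comp {A B D : C} (f : A ⟶ B) (g : B ⟶ D) (x : S) (n : ℤ) :
    ⇑(DGModule.cohomologyMap (U.map (f ≫ g) x) n) =
      DGModule.cohomologyMap (U.map g x) n ∘ DGModule.cohomologyMap (U.map f x) n := by
  rw [U.map_comp]
  exact DGModule.cohomologyMap_comp _ _ _

instance : (dgWeakEquivalences U).HasTwoOutOfThreeProperty where
  comp_mem f g hf hg x n := by
    rw [cohomologyMap_map_comp]
    exact (hg x n).comp (hf x n)
  of_postcomp f g hg hfg x n := by
    have := hfg x n
    rw [cohomologyMap_map_comp] at this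
    exact (Function.Bijective.of_comp_iff' (hg x n) _).1 this
  of_precomp f g hf hfg x n := by
    have := hfg x n
    rw [cohomologyMap_map_comp] at this
    exact (Function.Bijective.of_comp_iff _ (hf x n)).1 this

lemma dgWeakEquivalences_iso {A B : C} (e : A ≅ B) : dgWeakEquivalences U e.hom := fun x =>
  DGModule.isQuasiIso_of_iso ((Pi.eval (fun _ : S => DGModule 𝒜) x).mapIso (U.mapIso e))

/-- In cohomology, `f` is injective as a first factor of `j`, and it is surjective as the composite
of the bijection `j` with the split surjection `p`. -/
lemma dgWeakEquivalences_of_retract {X Y Z : C} {f : X ⟶ Y} {j : X ⟶ Z} {w : Y ⟶ Z} {p : Z ⟶ Y}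
    (hj : dgWeakEquivalences U j) (h₁ : f ≫ w = j) (h₂ : j ≫ p = f) (h₃ : w ≫ p = 𝟙 Y) :
    dgWeakEquivalences U f := fun x n => by
  have hj := hj x n
  constructor
  · rw [← h₁, cohomologyMap_map_comp] at hj
    exact hj.1.of_comp
  · have hp : Function.Surjective (DGModule.cohomologyMap (U.map p x) n) := by
      have := dgWeakEquivalences_iso (U := U) (Iso.refl Y) x n
      rw [Iso.refl_hom, ← h₃, cohomologyMap_map_comp] at this
      exact this.2.of_comp
    rw [← h₂, cohomologyMap_map_comp]
    exact hp.comp hj.2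

/-- A cocycle in the colimit, or an equation making a cocycle of `A` a boundary there, already
occurs at some stage, where `a k` is a quasi-isomorphism. -/
lemma dgWeakEquivalences_of_isColimit [PreservesFilteredColimits U] {J : Type v}
    [SmallCategory J] [IsFiltered J] {G : J ⥤ C} {c : Cocone G} (hc : IsColimit c) {A : C}
    (a : ∀ k, A ⟶ G.obj k) (ha : ∀ k, dgWeakEquivalences U (a k))
    (hG : ∀ {k l} (f : k ⟶ l), a k ≫ G.map f = a l) {j : A ⟶ c.pt}
    (hj : ∀ k, a k ≫ c.ι.app k = j) : dgWeakEquivalences U j := fun x => by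
  have comm (k : J) {m n : ℤ} (h : m + 1 = n) (y : (U.obj (G.obj k) x).X m) :
      (U.map (c.ι.app k) x).f n ((U.obj _ x).d h y) =
        (U.obj c.pt x).d h ((U.map (c.ι.app k) x).f m y) := (U.map (c.ι.app k) x).comm h y
  have ha' (k) := (DGModule.isQuasiIso_iff _).1 (ha k x)
  refine (DGModule.isQuasiIso_iff _).2 ⟨fun {l m n} h h' z y hz hy => ?_,
    fun {l m n} h h' y hy => ?_⟩
  · obtain ⟨k, y, rfl⟩ := dgEv_exists_rep U hc y
    obtain ⟨k', f, hf⟩ := dgEv_exists_of_rep_eq U hc ((U.map (a k) x).f m z) ((U.obj _ x).d h y)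
      (by rw [← map_comp_f, hj, hy, comm])
    rw [← map_comp_f, hG, (U.map (G.map f) x).comm] at hf
    exact (ha' k').1 h h' z _ hz hf
  · obtain ⟨k, y, rfl⟩ := dgEv_exists_rep U hc y
    obtain ⟨k', f, hf⟩ := dgEv_exists_of_rep_eq U hc ((U.obj _ x).d h' y) 0
      (by rw [map_zero, comm, hy])
    rw [map_zero, (U.map (G.map f) x).comm] at hf
    obtain ⟨z, w, hz, hw⟩ := (ha' k').2 h h' _ hf
    refine ⟨z, (U.map (c.ι.app k') x).f l w, hz, ?_⟩
    rw [← hj k', map_comp_f, hw, map_add, ← map_comp_f, c.w, comm]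

/-- The free extensions generated by finite subsets of a set of generators. -/
lemma FreeExt.weakEquivalence_of_finset [PreservesFilteredColimits U] {A D : C} {j : A ⟶ D}
    {T : Type v} {s : T → S} {deg : T → ℤ} {e : ∀ t {n : ℤ}, deg t = n → (U.obj D (s t)).X n}
    (H : FreeExt U j s deg e)
    (hfin : ∀ T' : Finset T, ∃ (D' : C) (j' : A ⟶ D')
      (e' : ∀ (t : T') {n : ℤ}, deg t = n → (U.obj D' (s t)).X n),
      dgWeakEquivalences U j' ∧ FreeExt U j' (fun t : T' => s t) (fun t => deg t) e') :
    dgWeakEquivalences U j := by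
  classical
  choose D' j' e' hw H' using hfin
  choose m hm hm' using fun {T₁ T₂ : Finset T} (h : T₁ ≤ T₂) =>
    (H' T₁).exists_hom (j' T₂) (fun t => e' T₂ ⟨t, h t.2⟩)
  let G : Finset T ⥤ C :=
    { obj := D'
      map := fun f => m f.le
      map_id := fun T₁ => (H' T₁).hom_ext _ _ (by rw [hm, Category.comp_id]) (fun t n h => by
        rw [hm', map_id_f])
      map_comp := fun {T₁ T₂ T₃} f g => (H' T₁).hom_ext _ _
        (by rw [hm, ← Category.assoc, hm, hm]) (fun t n h => by
          rw [hm', map_comp_f, hm', hm' g.le ⟨t, f.le t.2⟩]) }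
  choose i hi hi' using fun T₁ : Finset T => (H' T₁).exists_hom j (fun t => e t)
  let c : Cocone G :=
    { pt := D
      ι :=
        { app := i
          naturality := fun T₁ T₂ f => by
            refine (H' T₁).hom_ext _ _ ?_ fun t n h => ?_
            · change j' T₁ ≫ m f.le ≫ i T₂ = j' T₁ ≫ i T₁ ≫ 𝟙 D
              rw [Category.comp_id, hi, ← Category.assoc, hm, hi]
            · change (U.map (m f.le ≫ i T₂) _).f _ _ = (U.map (i T₁ ≫ 𝟙 D) _).f _ _
              rw [Category.comp_id, hi', map_comp_f, hm', hi' T₂ ⟨t, f.le t.2⟩] } }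
  -- A morphism from `D` is prescribed by its restriction to `A`, read at the empty subset, and by
  -- the images of the generators, each read at its singleton.
  have hdesc (r : Cocone G) : ∃ φ : D ⟶ r.pt, j ≫ φ = j' ∅ ≫ r.ι.app ∅ ∧
      ∀ t {n : ℤ} (h : deg t = n), (U.map φ (s t)).f n (e t h) =
        (U.map (r.ι.app {t}) (s t)).f n (e' {t} ⟨t, Finset.mem_singleton_self t⟩ h) :=
    H.exists_hom _ _
  choose φ hφ hφ' using hdesc
  have hc : IsColimit c :=
    { desc := φ
      fac := fun r T₁ => by
        refine (H' T₁).hom_ext _ _ ?_ fun t n h => ?_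
        · rw [← Category.assoc, show j' T₁ ≫ c.ι.app T₁ = j from hi T₁, hφ,
            ← r.w (homOfLE (Finset.empty_subset T₁)), ← Category.assoc]
          exact congrArg (· ≫ _) (hm _)
        · have h₁ : (U.map (c.ι.app T₁) (s t)).f n (e' T₁ t h) = e t h := hi' T₁ t h
          have h₂ : (U.map (G.map (homOfLE (Finset.singleton_subset_iff.2 t.2))) (s t)).f n
            (e' {t.1} ⟨t, Finset.mem_singleton_self _⟩ h) = e' T₁ t h :=
              hm' (Finset.singleton_subset_iff.2 t.2) ⟨t, Finset.mem_singleton_self _⟩ h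
          rw [map_comp_f, h₁, hφ', ← r.w (homOfLE (Finset.singleton_subset_iff.2 t.2)), map_comp_f,
            h₂]
      uniq := fun r ψ hψ => by
        refine H.hom_ext _ _ ?_ fun t n h => ?_
        · rw [hφ, ← hψ, ← Category.assoc]
          exact congrArg (· ≫ _) (hi ∅).symm
        · rw [hφ', ← hψ, map_comp_f]
          exact congrArg _ (hi' {t} ⟨t, Finset.mem_singleton_self t⟩ h).symm }
  exact dgWeakEquivalences_of_isColimit hc j' hw (fun f => hm f.le) hi

/-- There is one generator, of degree `-1`, in the component `x` and none elsewhere; the index type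
`PLift (y = x)` treats both cases uniformly. -/
lemma exists_dgBasis_dgK (x y : S) :
    ∃ g, (dgK 𝒜 x y).DGBasis (ι := ULift.{v} (PLift (y = x))) (fun _ => 0 - 1) g := by
  by_cases h : y = x
  · rw [dgK, if_pos h]
    have : Unique (ULift.{v} (PLift (y = x))) := ⟨⟨⟨⟨h⟩⟩⟩, fun _ => rfl⟩
    exact ⟨_, DGModule.dgBasis_cone (DGModule.grBasis_self _) fun _ _ => rfl⟩
  · rw [dgK, if_neg h]
    have : IsEmpty (ULift.{v} (PLift (y = x))) := ⟨fun t => h t.down.down⟩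
    exact ⟨_, DGModule.dgBasis_zero _ _⟩

variable [HasColimits C] (adj : F ⊣ U)
  (hK : ∀ (A : C) (x : S) (p : ℤ),
    DGIsQuasiIso (U.map (coprod.inr : A ⟶ F.obj (dgShift (dgK 𝒜 x) p) ⨿ A)))

include adj hK

/-- The generator of `𝕂_x[p]` has degree `-1 - p`, so `p = -1 - deg` gives the required degree. By
uniqueness of free extensions, the given one is then the coproduct inclusion of the hypothesis. -/
lemma FreeExt.weakEquivalence_unique {A D : C} {j : A ⟶ D} {s : PUnit.{v + 1} → S}
    {deg : PUnit.{v + 1} → ℤ} {e : ∀ t {n : ℤ}, deg t = n → (U.obj D (s t)).X n}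
    (H : FreeExt U j s deg e) : dgWeakEquivalences U j := by
  choose g hg using exists_dgBasis_dgK (𝒜 := 𝒜) (s ⟨⟩)
  obtain ⟨e', H'⟩ := exists_freeExt_of_isColimit (adj := adj)
    (coprodIsCoprod (F.obj (dgShift (dgK 𝒜 (s ⟨⟩)) (-1 - deg ⟨⟩))) A)
    (fun y => (hg y).shift (-1 - deg ⟨⟩))
  let ε : PUnit.{v + 1} ≃ Σ y, ULift.{v} (PLift (y = s ⟨⟩)) :=
    { toFun := fun _ => ⟨s ⟨⟩, ⟨⟨rfl⟩⟩⟩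
      invFun := fun _ => ⟨⟩
      left_inv := fun _ => rfl
      right_inv := by rintro ⟨_, ⟨⟨rfl⟩⟩⟩; rfl }
  obtain ⟨φ, hφ⟩ := FreeExt.exists_iso (H'.reindex ε deg (fun t => by
    change _ = 0 - 1 - (-1 - deg t); omega)) H
  rw [← hφ]
  exact (dgWeakEquivalences U).comp_mem _ _ (hK A (s ⟨⟩) _) (dgWeakEquivalences_iso φ)

lemma FreeExt.weakEquivalence_of_finite {T : Type v} [Finite T] :
    ∀ {A D : C} {j : A ⟶ D} {s : T → S} {deg : T → ℤ}
      {e : ∀ t {n : ℤ}, deg t = n → (U.obj D (s t)).X n}, FreeExt U j s deg e →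
      dgWeakEquivalences U j := by
  refine Finite.induction_empty_option (P := fun T : Type v => ∀ {A D : C} {j : A ⟶ D} {s : T → S}
    {deg : T → ℤ} {e : ∀ t {n : ℤ}, deg t = n → (U.obj D (s t)).X n}, FreeExt U j s deg e →
      dgWeakEquivalences U j) ?_ ?_ ?_ T
  · intro T T' ε h A D j s deg e H
    exact h (H.reindex ε _ fun _ => rfl)
  · intro A D j s deg e H
    obtain ⟨φ, h₁, -⟩ := H.exists_hom (𝟙 A) (fun t => t.elim)
    have h₂ : φ ≫ j = 𝟙 D := H.hom_ext _ _ (by rw [← Category.assoc, h₁]; simp) fun t => t.elim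
    exact dgWeakEquivalences_iso ⟨j, φ, h₁, h₂⟩
  · intro T _ h A D j s deg e H
    obtain ⟨D₁, j₁, e₁, -, H₁⟩ := exists_standardTrivialCofibration adj A (s ∘ some) (deg ∘ some)
    obtain ⟨D₂, j₂, e₂, -, H₂⟩ := exists_standardTrivialCofibration adj D₁
      (fun _ : PUnit.{v + 1} => s none) (fun _ => deg none)
    obtain ⟨φ, hφ⟩ := (FreeExt.comp_option H₁ H₂).exists_iso H
    rw [← hφ]
    exact (dgWeakEquivalences U).comp_mem _ _ ((dgWeakEquivalences U).comp_mem _ _ (h H₁)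
      (FreeExt.weakEquivalence_unique adj hK H₂)) (dgWeakEquivalences_iso φ)

lemma FreeExt.weakEquivalence [PreservesFilteredColimits U] {A D : C} {j : A ⟶ D}
    {T : Type v} {s : T → S} {deg : T → ℤ} {e : ∀ t {n : ℤ}, deg t = n → (U.obj D (s t)).X n}
    (H : FreeExt U j s deg e) : dgWeakEquivalences U j :=
  H.weakEquivalence_of_finset fun T' => by
    obtain ⟨D', j', e', -, H'⟩ := exists_standardTrivialCofibration adj A (fun t : T' => s t)
      (fun t => deg t)
    exact ⟨D', j', e', FreeExt.weakEquivalence_of_finite adj hK H', H'⟩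

end WeakEquivalences

/-! ### Lifting properties of the standard cofibrations -/

section ModelStructure

variable {K : Type v} [Ring K] {𝒜 : ℤ → AddSubgroup K} [GradedRing 𝒜] {S : Type v}
variable {C : Type u} [Category.{v} C] {F : (S → DGModule 𝒜) ⥤ C} {U : C ⥤ (S → DGModule 𝒜)}

lemma dgTrivialFibrations_iff {X Y : C} (p : X ⟶ Y) :
    (dgFibrations U ⊓ dgWeakEquivalences U) p ↔ ∀ x, DGModule.LiftsBoundaries (U.map p x) := by
  simp only [DGModule.liftsBoundaries_iff]
  exact ⟨fun h x => ⟨h.1 x, h.2 x⟩, fun h => ⟨fun x => (h x).1, fun x => (h x).2⟩⟩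

/-- A lift in a square from `A ⟶ A⟨M, α⟩` to `p` amounts to elements `b t` with `d (b t) = f (z t)`
and `p (b t) = g (e t)`, which is an instance of `LiftsBoundaries`. -/
lemma elementaryStandardCofibrations_le (adj : F ⊣ U) :
    elementaryStandardCofibrations adj ≤ dgCofibrations U := by
  intro A D j hj X Y p hp
  rw [dgTrivialFibrations_iff] at hp
  obtain ⟨T, s, deg, z, e, H, hz⟩ := hj.exists_killExt
  refine ⟨fun {f g} sq => ?_⟩
  choose b hb hb' using fun t : T => hp (s t) (rfl : deg t + 1 = deg t + 1) rfl
    ((U.map f (s t)).f _ (z t rfl)) ((U.map g (s t)).f _ (e t rfl))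
    (by rw [← (U.map f (s t)).comm, hz, map_zero])
    (by rw [← map_comp_f, sq.w, map_comp_f, ← H.d_e t rfl rfl rfl, (U.map g (s t)).comm])
  obtain ⟨φ, h₁, h₂⟩ := H.exists_hom f (fun t {n} h => (U.obj X (s t)).castHom h (b t))
    (by rintro t _ _ rfl rfl _; exact hb t)
  refine ⟨⟨⟨φ, h₁, H.hom_ext _ _ (by rw [← Category.assoc, h₁, sq.w]) fun t n h => ?_⟩⟩⟩
  subst h
  rw [map_comp_f, h₂]
  exact hb' t

lemma standardTrivialCofibrations_le (adj : F ⊣ U) :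
    standardTrivialCofibrations adj ≤ (dgFibrations U).llp := by
  intro A D j hj X Y p hp
  obtain ⟨T, s, deg, e, H⟩ := hj.exists_freeExt
  refine ⟨fun {f g} sq => ?_⟩
  choose b hb using fun t : T => hp (s t) (deg t) ((U.map g (s t)).f _ (e t rfl))
  obtain ⟨φ, h₁, h₂⟩ := H.exists_hom f (fun t {n} h => (U.obj X (s t)).castHom h (b t))
  refine ⟨⟨⟨φ, h₁, H.hom_ext _ _ (by rw [← Category.assoc, h₁, sq.w]) fun t n h => ?_⟩⟩⟩
  subst h
  rw [map_comp_f, h₂]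
  exact hb t

lemma standardCofibrations_le (adj : F ⊣ U) : standardCofibrations adj ≤ dgCofibrations U := by
  have := (dgFibrations U ⊓ dgWeakEquivalences U).isStableUnderTransfiniteCompositionOfShape_llp ℕ
  rw [MorphismProperty.isStableUnderTransfiniteCompositionOfShape_iff] at this
  exact (MorphismProperty.transfiniteCompositionsOfShape_monotone ℕ
    (elementaryStandardCofibrations_le adj)).trans this

lemma map_f_congr {A B : C} {f g : A ⟶ B} (h : f = g) (x : S) {n : ℤ} (y : (U.obj A x).X n) :
    (U.map f x).f n y = (U.map g x).f n y := by
  rw [h]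

lemma exists_retract_of_llp {X Y Z : C} {f : X ⟶ Y} {j : X ⟶ Z} {p : Z ⟶ Y}
    {W : MorphismProperty C} (hf : W.llp f) (hp : W p) (h : j ≫ p = f) :
    ∃ w : Y ⟶ Z, f ≫ w = j ∧ w ≫ p = 𝟙 Y := by
  have := hf p hp
  have sq : CommSq j f p (𝟙 Y) := ⟨by rw [h, Category.comp_id]⟩
  exact ⟨sq.lift, sq.fac_left, sq.fac_right⟩

/-! ### Smallness of the sources of the generators -/

section SmallObject

variable (U) in
/-- `A` represents the functor of cycles of degree `n` at `x`, by the universal cycle `ζ`. -/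
structure RepresentsCycles (x : S) {n : ℤ} (A : C) (ζ : (U.obj A x).X n) : Prop where
  d_eq_zero : ∀ {m : ℤ} (h : n + 1 = m), (U.obj A x).d h ζ = 0
  exists_hom : ∀ {B : C} (z : (U.obj B x).X n), (∀ {m : ℤ} (h : n + 1 = m),
    (U.obj B x).d h z = 0) → ∃ φ : A ⟶ B, (U.map φ x).f n ζ = z
  hom_ext : ∀ {B : C} (φ ψ : A ⟶ B), (U.map φ x).f n ζ = (U.map ψ x).f n ζ → φ = ψ

/-- Adjoin to the initial object one generator with zero differential. -/
lemma exists_representsCycles [HasColimits C] (adj : F ⊣ U) (x : S) (n : ℤ) :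
    ∃ (A : C) (ζ : (U.obj A x).X n), RepresentsCycles U x A ζ := by
  obtain ⟨A, j, e, -, H⟩ := exists_elementaryStandardCofibration adj (⊥_ C)
    (fun _ : PUnit.{v + 1} => x) (fun _ => n) (fun _ {_} _ => 0) (fun _ _ _ _ _ => map_zero _)
  refine ⟨A, e ⟨⟩ rfl, fun h => ?_, fun {B} z hz => ?_, fun φ ψ h => ?_⟩
  · rw [H.d_e ⟨⟩ rfl h h, map_zero]
  · obtain ⟨φ, -, h⟩ := H.exists_hom (initial.to B) (fun _ {_} h => (U.obj B x).castHom h z)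
      (by rintro _ _ _ rfl rfl _; rw [map_zero]; exact hz rfl)
    exact ⟨φ, h ⟨⟩ rfl⟩
  · refine H.hom_ext _ _ (initial.hom_ext _ _) ?_
    rintro _ _ rfl
    exact h

/-- Cycles commute with filtered colimits: a representative of a cycle becomes a cycle at a later
stage, and two cycles equal in the colimit become equal at a later stage. -/
lemma RepresentsCycles.preservesColimitsOfShape [PreservesFilteredColimits U] {x : S} {n : ℤ}
    {A : C} {ζ : (U.obj A x).X n} (H : RepresentsCycles U x A ζ) {J : Type v} [SmallCategory J]
    [IsFiltered J] : PreservesColimitsOfShape J (coyoneda.obj (Opposite.op A)) where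
  preservesColimit {G} := ⟨fun {c} hc => ⟨Types.FilteredColimit.isColimitOf' _ _
    (fun φ => by
      change A ⟶ c.pt at φ
      obtain ⟨k, z, hz⟩ := dgEv_exists_rep U hc ((U.map φ x).f n ζ)
      obtain ⟨l, f, hf⟩ := dgEv_exists_of_rep_eq U hc ((U.obj _ x).d (rfl : n + 1 = n + 1) z) 0
        (by
          rw [(U.map (c.ι.app k) x).comm, hz, map_zero]
          exact ((U.map φ x).comm rfl ζ).symm.trans (by rw [H.d_eq_zero, map_zero]))
      rw [map_zero, (U.map (G.map f) x).comm] at hf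
      obtain ⟨ψ, hψ⟩ := H.exists_hom ((U.map (G.map f) x).f n z) (by rintro _ rfl; exact hf)
      refine ⟨l, ψ, H.hom_ext _ _ ?_⟩
      change _ = (U.map (ψ ≫ c.ι.app l) x).f n ζ
      rw [map_comp_f, hψ, ← map_comp_f, c.w, hz])
    (fun k φ ψ h => by
      change A ⟶ G.obj k at φ ψ
      change φ ≫ c.ι.app k = ψ ≫ c.ι.app k at h
      obtain ⟨l, f, hf⟩ := dgEv_exists_of_rep_eq U hc ((U.map φ x).f n ζ) ((U.map ψ x).f n ζ)
        (by rw [← map_comp_f, h, map_comp_f])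
      refine ⟨l, f, H.hom_ext _ _ ?_⟩
      change (U.map (φ ≫ G.map f) x).f n ζ = (U.map (ψ ≫ G.map f) x).f n ζ
      rw [map_comp_f, hf, map_comp_f])⟩⟩

lemma preservesColimitsOfShape_coyoneda_initial [HasInitial C] {J : Type v} [SmallCategory J]
    [IsFiltered J] : PreservesColimitsOfShape J (coyoneda.obj (Opposite.op (⊥_ C))) where
  preservesColimit := ⟨fun _ => ⟨Types.FilteredColimit.isColimitOf' _ _
    (fun _ => ⟨IsFiltered.nonempty.some, initial.to _, initial.hom_ext _ _⟩)
    (fun k φ ψ _ => ⟨k, 𝟙 k, congrArg _ (initial.hom_ext φ ψ)⟩)⟩⟩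

lemma hasSmallObjectArgument_of_preservesColimits [HasColimits C] (I : MorphismProperty C)
    [MorphismProperty.IsSmall.{v} I]
    (hI : ∀ {A B : C} (i : A ⟶ B), I i → ∀ {J : Type v} [SmallCategory J] [IsFiltered J],
      PreservesColimitsOfShape J (coyoneda.obj (Opposite.op A))) :
    MorphismProperty.HasSmallObjectArgument.{v} I := by
  have := Cardinal.fact_isRegular_aleph0.{v}
  let := Cardinal.orderBotAleph0OrdToType.{v}
  exact ⟨Cardinal.aleph0, inferInstance, inferInstance,
    { preservesColimit := fun i hi f hf =>
        have := hI i hi (J := Cardinal.aleph0.{v}.ord.ToType)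
        inferInstance }⟩

end SmallObject

/-! ### Generating sets and the two factorizations -/

variable [HasColimits C] (adj : F ⊣ U)

/-- For each `x` and `n`, adjoin to the object representing cycles of degree `n + 1` an element of
degree `n` whose differential is the universal cycle. Squares from this morphism to `p` are
precisely the data `z`, `y` of `LiftsBoundaries`. -/
lemma exists_small_elementaryStandardCofibrations [PreservesFilteredColimits U] :
    ∃ I₀ : MorphismProperty C, I₀ ≤ elementaryStandardCofibrations adj ∧
      MorphismProperty.IsSmall.{v} I₀ ∧ MorphismProperty.HasSmallObjectArgument.{v} I₀ ∧
      I₀.rlp ≤ dgFibrations U ⊓ dgWeakEquivalences U := by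
  choose A ζ hA using fun q : S × ℤ => exists_representsCycles adj q.1 (q.2 + 1)
  choose D j e hj H using fun q : S × ℤ => exists_elementaryStandardCofibration adj (A q)
    (fun _ : PUnit.{v + 1} => q.1) (fun _ => q.2)
    (fun _ {_} h => (U.obj (A q) q.1).castHom h (ζ q))
    (by rintro _ _ _ rfl h; exact (hA q).d_eq_zero h)
  have hs : MorphismProperty.IsSmall.{v} (MorphismProperty.ofHoms j) := inferInstance
  refine ⟨MorphismProperty.ofHoms j, ?_, hs, hasSmallObjectArgument_of_preservesColimits _ ?_, ?_⟩
  · rintro _ _ _ ⟨q⟩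
    exact hj q
  · rintro _ _ _ ⟨q⟩ J _ _
    exact (hA q).preservesColimitsOfShape
  · intro X Y p hp
    rw [dgTrivialFibrations_iff]
    intro x m n l h h' z y hz hy
    subst h
    have := hp (j ⟨x, m⟩) ⟨_⟩
    obtain ⟨f, hf⟩ := (hA ⟨x, m⟩).exists_hom z (by rintro _ rfl; subst h'; exact hz)
    obtain ⟨g, hg, hg'⟩ := (H ⟨x, m⟩).exists_hom (f ≫ p)
      (fun _ {_} h => (U.obj Y x).castHom h y) (by
        rintro _ _ _ rfl rfl _
        refine Eq.trans hy.symm ?_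
        rw [← hf, ← map_comp_f]
        rfl)
    have sq : CommSq f (j ⟨x, m⟩) p g := ⟨hg.symm⟩
    refine ⟨(U.map sq.lift x).f m (e ⟨x, m⟩ ⟨⟩ rfl), ?_, ?_⟩
    · rw [← (U.map sq.lift x).comm]
      refine (congrArg _ ((H ⟨x, m⟩).d_e ⟨⟩ rfl rfl rfl)).trans ?_
      rw [← map_comp_f, sq.fac_left]
      exact hf
    · rw [← map_comp_f, sq.fac_right]
      exact hg' ⟨⟩ rfl

/-- Adjoin one free generator to the initial object: a lift against this morphism is a preimage of
one homogeneous element. -/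
lemma exists_small_standardTrivialCofibrations :
    ∃ J₀ : MorphismProperty C, J₀ ≤ standardTrivialCofibrations adj ∧
      MorphismProperty.IsSmall.{v} J₀ ∧ MorphismProperty.HasSmallObjectArgument.{v} J₀ ∧
      J₀.rlp ≤ dgFibrations U := by
  choose D j e hj H using fun q : S × ℤ => exists_standardTrivialCofibration adj (⊥_ C)
    (fun _ : PUnit.{v + 1} => q.1) (fun _ => q.2)
  have hs : MorphismProperty.IsSmall.{v} (MorphismProperty.ofHoms j) := inferInstance
  refine ⟨MorphismProperty.ofHoms j, ?_, hs, hasSmallObjectArgument_of_preservesColimits _ ?_, ?_⟩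
  · rintro _ _ _ ⟨q⟩
    exact hj q
  · rintro _ _ _ ⟨q⟩ J _ _
    exact preservesColimitsOfShape_coyoneda_initial
  · intro X Y p hp x n y
    have := hp (j ⟨x, n⟩) ⟨_⟩
    obtain ⟨g, -, hg⟩ := (H ⟨x, n⟩).exists_hom (initial.to Y)
      (fun _ {_} h => (U.obj Y x).castHom h y)
    have sq : CommSq (initial.to X) (j ⟨x, n⟩) p g := ⟨initial.hom_ext _ _⟩
    refine ⟨(U.map sq.lift x).f n (e ⟨x, n⟩ ⟨⟩ rfl), ?_⟩
    rw [← map_comp_f, sq.fac_right]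
    exact hg ⟨⟩ rfl

lemma elementaryStandardCofibrations_rlp [PreservesFilteredColimits U] :
    (elementaryStandardCofibrations adj).rlp = dgFibrations U ⊓ dgWeakEquivalences U := by
  obtain ⟨I₀, h₁, -, -, h₂⟩ := exists_small_elementaryStandardCofibrations adj
  exact le_antisymm ((MorphismProperty.antitone_rlp h₁).trans h₂)
    (MorphismProperty.le_llp_iff_le_rlp _ _ |>.1 (elementaryStandardCofibrations_le adj))

lemma standardTrivialCofibrations_rlp :
    (standardTrivialCofibrations adj).rlp = dgFibrations U := by
  obtain ⟨I₀, h₁, -, -, h₂⟩ := exists_small_standardTrivialCofibrations adj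
  exact le_antisymm ((MorphismProperty.antitone_rlp h₁).trans h₂)
    (MorphismProperty.le_llp_iff_le_rlp _ _ |>.1 (standardTrivialCofibrations_le adj))

/-- The shift by `-1` followed by the shift by `1` is isomorphic to the identity. -/
lemma nonempty_shift_neg_shift_iso (M : S → DGModule 𝒜) :
    Nonempty (dgShift (dgShift M (-1)) 1 ≅ M) := by
  have h₁ : ((-1 : ℤ).negOnePow : ℤ) = -1 := by rw [Int.negOnePow_neg, Int.negOnePow_one]; rfl
  have h₂ : ((1 : ℤ).negOnePow : ℤ) = -1 := by rw [Int.negOnePow_one]; rfl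
  have hd (x : S) {m n : ℤ} (h : m + 1 = n) (z : (dgShift (dgShift M (-1)) 1 x).X m) :
      (dgShift (dgShift M (-1)) 1 x).d h z =
        (M x).d (show m + 1 + -1 + 1 = n + 1 + -1 by omega) z := by
    change ((1 : ℤ).negOnePow : ℤ) • ((-1 : ℤ).negOnePow : ℤ) • (M x).d _ z = _
    rw [h₁, h₂, smul_smul, neg_mul_neg, one_mul, _root_.one_smul]
  let φ : dgShift (dgShift M (-1)) 1 ⟶ M := fun x =>
    { f := fun n => (M x).castHom (show n + 1 + -1 = n by omega)
      comm := fun h z => (congrArg _ (hd x h z)).trans ((M x).castHom_d _ _ _ _ z)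
      map_smul := fun h a z => (M x).castHom_smul _ _ _ _ a z }
  let ψ : M ⟶ dgShift (dgShift M (-1)) 1 := fun x =>
    { f := fun n => (M x).castHom (show n = n + 1 + -1 by omega)
      comm := fun h z => ((M x).castHom_d _ _ _ _ z).trans (hd x h _).symm
      map_smul := fun h a z => (M x).castHom_smul _ _ _ _ a z }
  have hcast (x : S) {m n : ℤ} (h : m = n) (h' : n = m) (z : (M x).X m) :
      (M x).castHom h' ((M x).castHom h z) = z := by
    subst h
    rfl
  refine ⟨⟨φ, ψ, ?_, ?_⟩⟩
  · funext x
    exact DGModule.hom_ext fun n z => hcast x _ _ z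
  · funext x
    exact DGModule.hom_ext fun n z => hcast x _ _ z

/-- One free generator is adjoined for each homogeneous element of `U Y` and sent to that element,
which makes `p` surjective. -/
lemma exists_factorization_standardTrivialCofibration {X Y : C} (f : X ⟶ Y) :
    ∃ (N M : S → DGModule 𝒜) (Z : C) (i : F.obj (dgShift M 1) ⟶ Z) (j : X ⟶ Z) (p : Z ⟶ Y),
      DGIsFree N ∧ Nonempty (dgShift M 1 ≅ dgCone (𝟙 (dgShift N (-1)))) ∧
      IsKilling adj (dgZero M (U.obj X)) j ∧ Nonempty (IsColimit (BinaryCofan.mk i j)) ∧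
      standardTrivialCofibrations adj j ∧ dgFibrations U p ∧ j ≫ p = f := by
  let T := Σ x, Σ n, (U.obj Y x).X n
  let s : T → S := fun t => t.1
  let deg : T → ℤ := fun t => t.2.1
  -- The shift by `-1` makes `M[1]` the required cone, so that attaching `M` along zero is the
  -- coproduct with `F (M[1])`.
  let M := dgShift (dgCone (𝟙 (dgShift (dgFreeOn 𝒜 s deg) (-1)))) (-1)
  obtain ⟨Z, j, hj⟩ := exists_isKilling adj (dgZero M (U.obj X))
  obtain ⟨i, ⟨hi⟩⟩ := hj.exists_isColimit
  obtain ⟨g, hg⟩ := exists_dgBasis_cone_dgFreeOn (𝒜 := 𝒜) s deg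
  obtain ⟨e, he⟩ := exists_freeExt_of_isColimit (adj := adj) hi
    (fun x => ((hg x).shift (-1)).shift 1)
  have H := he.reindex (fiberEquiv s deg) deg (fun t => by
    change _ = - -(deg t) - -1 - 1 - -1 - 1; omega)
  obtain ⟨p, hp, hp'⟩ := H.exists_hom f (fun t {_} h => (U.obj Y t.1).castHom h t.2.2)
  -- Here `M` is a shifted cone of an identity, not literally of the form required of a standard
  -- trivial cofibration. One of that form on the same generators is isomorphic to `j` under `X`, by
  -- uniqueness of free extensions.
  obtain ⟨Z', j', e', hj', H'⟩ := exists_standardTrivialCofibration adj X s deg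
  obtain ⟨φ, hφ⟩ := H'.exists_iso H
  refine ⟨dgFreeOn 𝒜 s deg, M, Z, i, j, p, dgFreeOn_isFree s deg, nonempty_shift_neg_shift_iso _,
    hj, ⟨hi⟩, ?_, fun x n y => ⟨_, hp' ⟨x, n, y⟩ rfl⟩, hp⟩
  obtain ⟨N', α, hN', hα⟩ := hj'
  exact ⟨N', α, hN', hφ ▸ hα.of_iso φ⟩

/-- One step in the construction of the factorization of a morphism into a standard cofibration and
a trivial fibration. -/
lemma exists_elementary_step {Y : C} (A : Over Y) :
    ∃ (B : Over Y) (i : A ⟶ B), elementaryStandardCofibrations adj i.left ∧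
      ∀ (x : S) {m n l : ℤ} (h : m + 1 = n) (h' : n + 1 = l) (z : (U.obj A.left x).X n)
        (y : (U.obj Y x).X m), (U.obj A.left x).d h' z = 0 →
        (U.map A.hom x).f n z = (U.obj Y x).d h y →
        ∃ w : (U.obj B.left x).X m, (U.obj B.left x).d h w = (U.map i.left x).f n z ∧
          (U.map B.hom x).f m w = y := by
  let T := Σ x, Σ m, {q : (U.obj A.left x).X (m + 1) × (U.obj Y x).X m //
    (U.obj A.left x).d rfl q.1 = 0 ∧ (U.map A.hom x).f _ q.1 = (U.obj Y x).d rfl q.2}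
  obtain ⟨D, j, e, hj, H⟩ := exists_elementaryStandardCofibration adj A.left
    (fun t : T => t.1) (fun t => t.2.1) (fun t {_} h => (U.obj A.left t.1).castHom h t.2.2.1.1)
    (by rintro t _ _ rfl rfl; exact t.2.2.2.1)
  obtain ⟨p, hp, hp'⟩ := H.exists_hom A.hom (fun t {_} h => (U.obj Y t.1).castHom h t.2.2.1.2)
    (by rintro t _ _ rfl rfl _; exact t.2.2.2.2.symm)
  refine ⟨Over.mk p, Over.homMk j hp, hj, fun x m n l h h' z y hz hy => ?_⟩
  subst h h'
  exact ⟨e ⟨x, m, ⟨z, y⟩, hz, hy⟩ rfl, H.d_e ⟨x, m, ⟨z, y⟩, hz, hy⟩ rfl rfl rfl,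
    hp' ⟨x, m, ⟨z, y⟩, hz, hy⟩ rfl⟩

/-- Every lifting problem `(z, y)` present at stage `k` is solved at stage `k + 1`, and every
problem in the colimit comes from some stage. Surjectivity of `p` needs no separate treatment, being
part of `LiftsBoundaries`. -/
lemma exists_factorization_standardCofibration [PreservesFilteredColimits U] {X Y : C}
    (f : X ⟶ Y) :
    ∃ (Z : C) (j : X ⟶ Z) (p : Z ⟶ Y), standardCofibrations adj j ∧
      (dgFibrations U ⊓ dgWeakEquivalences U) p ∧ j ≫ p = f := by
  have : HasColimitsOfSize.{0, 0} C := hasColimitsOfSizeShrink.{0, 0} C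
  choose B i hi hlift using fun A : Over Y => exists_elementary_step adj A
  let A : ℕ → Over Y := fun n => Nat.rec (Over.mk f) (fun _ A => B A) n
  let G : ℕ ⥤ C := Functor.ofSequence (X := fun n => (A n).left) (fun n => (i (A n)).left)
  have hG (n : ℕ) : G.map (homOfLE (Nat.le_add_right n 1)) = (i (A n)).left :=
    Functor.ofSequence_map_homOfLE_succ _ n
  let c : Cocone G :=
    { pt := Y
      ι := NatTrans.ofSequence (fun n => (A n).hom) (fun n => by
        rw [hG]
        exact (Over.w (i (A n))).trans (Category.comp_id _).symm) }
  have hc (n : ℕ) : colimit.ι G n ≫ colimit.desc G c = (A n).hom := colimit.ι_desc c n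
  refine ⟨colimit G, colimit.ι G 0, colimit.desc G c, ⟨{
      F := G
      isoBot := Iso.refl _
      incl := (colimit.cocone G).ι
      isColimit := colimit.isColimit G
      fac := Category.id_comp _
      map_mem := fun n _ => ?_ }⟩, ?_, hc 0⟩
  · have := hi (A n)
    rw [← hG] at this
    exact this
  · rw [dgTrivialFibrations_iff]
    intro x m n l h h' z y hz hy
    obtain ⟨k, z, rfl⟩ := dgEv_exists_rep U (colimit.isColimit G) z
    -- A later stage is needed only for the representative to become a cycle. The equation over `Y`
    -- holds at every stage, since the target is fixed.
    obtain ⟨k', g, hg⟩ := dgEv_exists_of_rep_eq U (colimit.isColimit G) ((U.obj _ x).d h' z) 0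
      (by
        rw [map_zero, (U.map _ x).comm]
        exact hz)
    rw [map_zero, (U.map (G.map g) x).comm] at hg
    have e₁ : (U.map (colimit.ι G k) x).f n z =
        (U.map (colimit.ι G k') x).f n ((U.map (G.map g) x).f n z) := by
      rw [← map_comp_f, colimit.w]
    obtain ⟨w, hw, hw'⟩ := hlift (A k') x h h' _ y hg (by
      refine Eq.trans ?_ ((congrArg _ e₁.symm).trans hy)
      exact (map_f_congr (U := U) (hc k').symm x _).trans (map_comp_f _ _ x _))
    refine ⟨(U.map (colimit.ι G (k' + 1)) x).f m w, ?_, ?_⟩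
    · refine ((U.map (colimit.ι G (k' + 1)) x).comm h w).symm.trans
        ((congrArg _ hw).trans (Eq.trans ?_ e₁.symm))
      refine (map_comp_f (U := U) (i (A k')).left (colimit.ι G (k' + 1)) x _).symm.trans
        (map_f_congr (U := U) ?_ x _)
      exact (congrArg (· ≫ colimit.ι G (k' + 1)) (hG k')).symm.trans (colimit.w G _)
    · refine (map_comp_f (U := U) (colimit.ι G (k' + 1)) (colimit.desc G c) x w).symm.trans
        ((map_f_congr (U := U) (hc (k' + 1)) x w).trans hw')

lemma standardTrivialCofibrations_le_weakEquivalences [PreservesFilteredColimits U]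
    (hK : ∀ (A : C) (x : S) (p : ℤ),
      DGIsQuasiIso (U.map (coprod.inr : A ⟶ F.obj (dgShift (dgK 𝒜 x) p) ⨿ A))) :
    standardTrivialCofibrations adj ≤ dgWeakEquivalences U := by
  intro A D j hj
  obtain ⟨T, s, deg, e, H⟩ := hj.exists_freeExt
  exact H.weakEquivalence adj hK

/-- Factor `f = j ≫ p` with `j` a standard trivial cofibration. If `f` lifts against fibrations, it
is a retract of `j`, hence a weak equivalence. If `f` is a cofibration and a weak equivalence,
two-out-of-three makes `p` a trivial fibration, so `f` is again a retract of `j` and inherits its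
lifting property. -/
lemma dgFibrations_llp (adj : F ⊣ U) [PreservesFilteredColimits U]
    (hK : ∀ (A : C) (x : S) (p : ℤ),
      DGIsQuasiIso (U.map (coprod.inr : A ⟶ F.obj (dgShift (dgK 𝒜 x) p) ⨿ A))) :
    (dgFibrations U).llp = dgCofibrations U ⊓ dgWeakEquivalences U := by
  ext X Y f
  obtain ⟨N, M, Z, i, j, p, -, -, -, -, hj, hp, h⟩ :=
    exists_factorization_standardTrivialCofibration adj f
  have hj' := standardTrivialCofibrations_le_weakEquivalences adj hK j hj
  refine ⟨fun hf => ⟨MorphismProperty.antitone_llp inf_le_left f hf, ?_⟩, fun hf => ?_⟩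
  · obtain ⟨w, hw, hw'⟩ := exists_retract_of_llp hf hp h
    exact dgWeakEquivalences_of_retract hj' hw h hw'
  · have hp' : dgWeakEquivalences U p :=
      (dgWeakEquivalences U).of_precomp j p hj' (by rw [h]; exact hf.2)
    obtain ⟨w, hw, hw'⟩ := exists_retract_of_llp hf.1 ⟨hp, hp'⟩ h
    refine MorphismProperty.of_retract (P := (dgFibrations U).llp)
      ({ i := Arrow.homMk (𝟙 X) w ((Category.id_comp _).trans hw.symm)
         r := Arrow.homMk (𝟙 X) p ((Category.id_comp _).trans h.symm)
         retract := ?_ } : RetractArrow f j) (standardTrivialCofibrations_le adj j hj)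
    ext
    · exact Category.id_comp _
    · exact hw'

end ModelStructure

theorem mainTheorem2 {K : Type v} [Ring K] (𝒜 : ℤ → AddSubgroup K) [GradedRing 𝒜]
    (hcomm : ∀ (i j : ℤ) (a b : K), a ∈ 𝒜 i → b ∈ 𝒜 j →
      a * b = (((i * j).negOnePow : ℤˣ) : ℤ) • (b * a))
    (S : Type v) {C : Type u} [Category.{v} C] [HasLimits C] [HasColimits C]
    (F : (S → DGModule 𝒜) ⥤ C) (U : C ⥤ (S → DGModule 𝒜)) (adj : F ⊣ U)
    (hU : PreservesFilteredColimits U)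
    (hK : ∀ (A : C) (x : S) (p : ℤ),
      DGIsQuasiIso (U.map (coprod.inr : A ⟶ F.obj (dgShift (dgK 𝒜 x) p) ⨿ A))) :
    ∃ _ : ModelCategory C,
      weakEquivalences C = dgWeakEquivalences U ∧
      fibrations C = dgFibrations U ∧
      cofibrations C = dgCofibrations U ∧
      (∀ {X Y : C} (f : X ⟶ Y), trivialCofibrations C f →
        ∃ (N M : S → DGModule 𝒜) (Z : C) (i : F.obj (dgShift M 1) ⟶ Z) (j : X ⟶ Z)
          (w : Y ⟶ Z) (p : Z ⟶ Y),
          DGIsFree N ∧ Nonempty (dgShift M 1 ≅ dgCone (𝟙 (dgShift N (-1)))) ∧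
          IsKilling adj (dgZero M (U.obj X)) j ∧
          Nonempty (IsColimit (BinaryCofan.mk i j)) ∧
          standardTrivialCofibrations adj j ∧
          trivialFibrations C p ∧ f ≫ w = j ∧ j ≫ p = f ∧ w ≫ p = 𝟙 Y) ∧
      (∀ {X Y : C} (f : X ⟶ Y), cofibrations C f →
        ∃ (Z : C) (j : X ⟶ Z) (w : Y ⟶ Z) (p : Z ⟶ Y),
          standardCofibrations adj j ∧
          trivialFibrations C p ∧ f ≫ w = j ∧ j ≫ p = f ∧ w ≫ p = 𝟙 Y) ∧
      IsCofibrantlyGeneratedBy (elementaryStandardCofibrations adj)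
        (standardTrivialCofibrations adj) := by
  let : CategoryWithFibrations C := ⟨dgFibrations U⟩
  let : CategoryWithCofibrations C := ⟨dgCofibrations U⟩
  let : CategoryWithWeakEquivalences C := ⟨dgWeakEquivalences U⟩
  have hllp := dgFibrations_llp adj hK
  have hW : (weakEquivalences C).HasTwoOutOfThreeProperty :=
    inferInstanceAs (dgWeakEquivalences U).HasTwoOutOfThreeProperty
  have h₁ : MorphismProperty.IsWeakFactorizationSystem (cofibrations C) (trivialFibrations C) :=
    { rlp := le_antisymm
        ((MorphismProperty.antitone_rlp (elementaryStandardCofibrations_le adj)).trans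
          (elementaryStandardCofibrations_rlp adj).le)
        (MorphismProperty.le_llp_iff_le_rlp _ _ |>.1 le_rfl)
      llp := rfl
      hasFactorization := ⟨fun f => by
        obtain ⟨Z, j, p, hj, hp, h⟩ := exists_factorization_standardCofibration adj f
        exact ⟨⟨Z, j, p, h, standardCofibrations_le adj j hj, hp⟩⟩⟩ }
  have h₂ : MorphismProperty.IsWeakFactorizationSystem (trivialCofibrations C) (fibrations C) :=
    { rlp := le_antisymm
        ((MorphismProperty.antitone_rlp ((standardTrivialCofibrations_le adj).trans hllp.le)).trans
          (standardTrivialCofibrations_rlp adj).le)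
        (MorphismProperty.le_llp_iff_le_rlp _ _ |>.1 hllp.ge)
      llp := hllp
      hasFactorization := ⟨fun f => by
        obtain ⟨N, M, Z, i, j, p, -, -, -, -, hj, hp, h⟩ :=
          exists_factorization_standardTrivialCofibration adj f
        exact ⟨⟨Z, j, p, h, hllp.le j (standardTrivialCofibrations_le adj j hj), hp⟩⟩⟩ }
  let m : ModelCategory C := ModelCategory.mk' C
  refine ⟨m, rfl, rfl, rfl, fun {X Y} f hf => ?_, fun {X Y} f hf => ?_, ?_⟩
  · obtain ⟨N, M, Z, i, j, p, hN, hM, hα, hi, hj, hp, h⟩ :=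
      exists_factorization_standardTrivialCofibration adj f
    -- The factorization only provides a fibration `p`. It is trivial because both `f` and `j` are
    -- weak equivalences, which lets the cofibration `f` lift against it.
    have hp' : dgWeakEquivalences U p := (dgWeakEquivalences U).of_precomp j p
      (standardTrivialCofibrations_le_weakEquivalences adj hK j hj) (by rw [h]; exact hf.2)
    obtain ⟨w, hw, hw'⟩ := exists_retract_of_llp hf.1 ⟨hp, hp'⟩ h
    exact ⟨N, M, Z, i, j, w, p, hN, hM, hα, hi, hj, ⟨hp, hp'⟩, hw, h, hw'⟩
  · obtain ⟨Z, j, p, hj, hp, h⟩ := exists_factorization_standardCofibration adj f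
    obtain ⟨w, hw, hw'⟩ := exists_retract_of_llp hf hp h
    exact ⟨Z, j, w, p, hj, hp, hw, h, hw'⟩
  · have hI := elementaryStandardCofibrations_rlp adj
    have hJ := standardTrivialCofibrations_rlp adj
    exact
      { trivialFibrations_eq := hI.symm
        fibrations_eq := hJ.symm
        cofibrations_eq := by rw [hI]; rfl
        trivialCofibrations_eq := by rw [hJ, hllp]; rfl
        exists_small_I := by
          obtain ⟨I₀, h₁, hs, ho, h₂⟩ := exists_small_elementaryStandardCofibrations adj
          exact ⟨I₀, h₁, hs, ho, le_antisymm (h₂.trans hI.ge) (MorphismProperty.antitone_rlp h₁)⟩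
        exists_small_J := by
          obtain ⟨J₀, h₁, hs, ho, h₂⟩ := exists_small_standardTrivialCofibrations adj
          exact ⟨J₀, h₁, hs, ho, le_antisymm (h₂.trans hJ.ge) (MorphismProperty.antitone_rlp h₁)⟩ }
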